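/- **Setting.** Let $N$ be a lattice of finite rank $r\ge 0$, $M=\operatorname{Hom}(N,\mathbb Z)$, $N_{\mathbb R}=N\otimes\mathbb R$. A vector $v$ of a lattice is primitive if it is nonzero and not a proper positive multiple of another vector; it has index $k\ge 0$ if it is $k$ times a primitive vector. Let $\Gamma$ be a tropical curve in $N_{\mathbb R}$ with a nonempty finite vertex set $\Gamma^{[0]}$, compact edges $\Gamma^{[1]}_c$, and non-compact edges $E_i$ labelled by a finite set $I$: a finite connected graph with edge weights $w(E)\in\mathbb Z_{\ge 0}$, vertex genera $g(V)\in\mathbb Z_{\ge0}$ (positive at univalent and bivalent vertices), and a map $h:\Gamma\to N_{\mathbb R}$ which embeds each edge $E$ with $w(E)>0$ as a segment or ray with primitive integral direction $u_{(V,E)}$ at its vertex $V$, contracts each edge with $w(E)=0$ (then $u_{(V,E)}:=0$), and is balanced: $\sum_{E\ni V}w(E)u_{(V,E)}=0$ for every $V$. For $E_i$ write $u_i$ for its direction and $\Delta(i)=w(E_i)u_i$. The genus is $b_1(\Gamma)+\sum_V g(V)$; put $\operatorname{ov}(V)=\operatorname{val}(V)+3g(V)-3$ and $d^{\mathrm{trop}}=\#I+(r-3)(1-g)-\sum_V\operatorname{ov}(V)$.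 Let $\mathbf A=(A_i)_{i\in I}$ be affine subspaces of $N_{\mathbb R}$ of rational slope, with weights $w_i\in\mathbb Z_{\ge1}$ (equal to $1$ in the basic case), let $L(A_i)$ be the linear space parallel to $A_i$, and let $\Psi=(s_i)$ be non-negative integers indexed by the contracted non-compact edges. Assume that $\Gamma$ has genus $0$, matches $\mathbf A$ ($h(E_i)\subset A_i$ for all $i$), satisfies $\Psi$ ($\operatorname{ov}(V)\ge\sum s_i$ over the contracted $E_i\ni V$, for every $V$), is non-superabundant (no contracted loops, no vertices of positive genus, and the space of curves of the combinatorial type of $\Gamma$ has dimension $d^{\mathrm{trop}}$), and that $\sum_{i\in I}\operatorname{codim}A_i=d^{\mathrm{trop}}$. (When $\mathbf A$ is generic up to translation, these conditions say that $\Gamma$ is rigid; genericity itself is not needed below.) Let $$\Phi:\prod_{V\in\Gamma^{[0]}}N\to\prod_{E\in\Gamma^{[1]}_c}N/(\mathbb R u_E\cap N)\times\prod_{i\in I}N/(L(A_i)\cap N),\qquad H\mapsto\big((H_{\partial^+E}-H_{\partial^-E})_E,(H_{\partial E_i})_i\big),$$ and $\operatorname{Mult}(\Gamma)=\operatorname{index}(\Phi)\prod_{E\in\Gamma^{[1]}_c}w(E)$,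 where an infinite index is read as $0$. Let $V_\infty$ be a vertex, and let $\Gamma$ be equipped with a flow towards $V_\infty$: an acyclic orientation of the edges, the non-compact ones oriented inwards, with $V_\infty$ as only sink. On the algebra $\mathbb Z[N]\otimes\Lambda^*M$, with product $(z^n\alpha)(z^m\beta)=z^{n+m}\alpha\wedge\beta$, let $\ell_1(z^n\alpha)=z^n\iota_n\alpha$ (contraction by $n$) and $\ell_k(\zeta_1,\dots,\zeta_k)=\ell_1(\zeta_1\cdots\zeta_k)$. Let $\alpha_{A_i}$ be an element of index $w_i$ in $\Lambda^{\operatorname{codim}A_i}M$ with $\iota_v\alpha_{A_i}=0$ for all $v\in L(A_i)\cap N$. Assign elements $\zeta_E$ to the edges inductively: $\zeta_{E_i}=z^{\Delta(i)}\alpha_{A_i}$ for $i\in I$, and if $E_1,\dots,E_k$ are the edges flowing into $V\ne V_\infty$, in any order, and $E_{\mathrm{out}}$ is the edge flowing out of $V$, then $\zeta_{E_{\mathrm{out}}}=\ell_k(\zeta_{E_1},\dots,\zeta_{E_k})$. **Theorem.** 1. If $\Gamma$ is isolated among the curves of its combinatorial type that match $\mathbf A$, then $\Phi$ is injective of finite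 index. 2. Such a family $(\zeta_E)_E$ exists, and each $\zeta_E$ is well defined up to sign. It has the form $\zeta_E=z^{n_E}\alpha_E$, where $n_E$ is the weighted direction of $E$ pointing opposite to the flow. 3. The product $\prod_{E\ni V_\infty}\zeta_E$, in any order, equals $z^0\omega$ with $\omega\in\Lambda^rM$, the index of $\omega$ in $\Lambda^rM$ is $\big(\prod_iw_i\big)\operatorname{Mult}(\Gamma)$, and for every primitive $\Omega\in\Lambda^rN$ $$\big|\langle\Omega,\omega\rangle\big|=\Big(\prod_{i\in I}w_i\Big)\operatorname{Mult}(\Gamma).$$ In particular, if all $w_i=1$, then $\operatorname{Mult}(\Gamma)=\big|\big\langle\Omega,\prod_{E\ni V_\infty}\zeta_E\big\rangle\big|$. -/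

import Mathlib

open scoped TensorProduct

noncomputable section

namespace TropicalCurves

/-! ### Lattices -/

section Lattice

variable {L : Type*} [AddCommGroup L]

/-- A primitive vector of a lattice: nonzero (the case `k = 0`) and not a proper positive multiple
of another vector. -/
def IsPrimitive (v : L) : Prop :=
  ∀ (k : ℕ) (v' : L), k • v' = v → k = 1

/-- `v` has index `k`: it is `k` times a primitive vector. -/
def HasIndex (v : L) (k : ℕ) : Prop :=
  ∃ v' : L, IsPrimitive v' ∧ v = k • v'

end Lattice

section RealSpace

variable (N : Type*) [AddCommGroup N]

/-- The real vector space `N_ℝ = ℝ ⊗ N`. -/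
abbrev RealSpace : Type _ := ℝ ⊗[ℤ] N

/-- The dual lattice `M = Hom(N, ℤ)`. -/
abbrev DualLattice : Type _ := Module.Dual ℤ N

variable {N}

/-- The natural map `N → N_ℝ`, `n ↦ 1 ⊗ n`. -/
def toReal : N →ₗ[ℤ] RealSpace N := TensorProduct.mk ℤ ℝ N 1

/-- `W ∩ N`, for a linear subspace `W` of `N_ℝ`. -/
def latticePoints (W : Submodule ℝ (RealSpace N)) : Submodule ℤ N :=
  (W.restrictScalars ℤ).comap toReal

/-- A linear subspace of `N_ℝ` has rational slope if it is spanned by lattice vectors. -/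
def IsRational (W : Submodule ℝ (RealSpace N)) : Prop :=
  Submodule.span ℝ (toReal '' (latticePoints W : Set N)) = W

end RealSpace

/-! ### Tropical curves

`V` is the set of vertices, `E` the set of compact edges, and the non-compact edges ("legs") are
identified with the index set `I` by the marking. Loops and multiple edges are allowed. A curve is
recorded by its combinatorial type together with the positions of its vertices; the map on the
edges is determined by this up to reparametrization. -/

variable {N I V E : Type*} [AddCommGroup N]
  [Fintype I] [Fintype V] [DecidableEq V] [Fintype E]

/-- The valence of a vertex of the graph with the given incidence maps (a loop counts twice). -/
def graphValence (src tgt : E → V) (leg : I → V) (v : V) : ℕ :=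
  (∑ e, if src e = v then 1 else 0) + (∑ e, if tgt e = v then 1 else 0) +
    (∑ i, if leg i = v then 1 else 0)

variable (N I V E) in
/-- The combinatorial type of a marked tropical curve with at least one vertex. -/
structure TropicalType where
  /-- the end `∂⁺E` of a compact edge -/
  src : E → V
  /-- the end `∂⁻E` of a compact edge -/
  tgt : E → V
  /-- the vertex of a leg -/
  leg : I → V
  /-- the weights `w(E)` of the compact edges -/
  edgeWeight : E → ℕ
  /-- the weights `w(E_i)` of the legs -/
  legWeight : I → ℕ
  /-- the genus of a vertex -/
  vertexGenus : V → ℕ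
  /-- the vector `u_(∂⁺E, E)`; thus `u_(∂⁻E, E) = - u_(∂⁺E, E)` -/
  edgeDir : E → N
  /-- the vector `u_i` -/
  legDir : I → N
  edgeDir_primitive : ∀ e, 0 < edgeWeight e → IsPrimitive (edgeDir e)
  edgeDir_zero : ∀ e, edgeWeight e = 0 → edgeDir e = 0
  legDir_primitive : ∀ i, 0 < legWeight i → IsPrimitive (legDir i)
  legDir_zero : ∀ i, legWeight i = 0 → legDir i = 0
  nonempty : Nonempty V
  connected : ∀ a b : V, Relation.EqvGen (fun x y => ∃ e, src e = x ∧ tgt e = y) a b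
  /-- univalent and bivalent vertices have positive genus -/
  stable : ∀ v, graphValence src tgt leg v = 1 ∨ graphValence src tgt leg v = 2 →
    0 < vertexGenus v
  /-- the balancing condition -/
  balanced : ∀ v,
    (∑ e, if src e = v then edgeWeight e • edgeDir e else 0) +
      (∑ e, if tgt e = v then edgeWeight e • -edgeDir e else 0) +
      (∑ i, if leg i = v then legWeight i • legDir i else 0) = 0

namespace TropicalType

variable (T : TropicalType N I V E)

/-- The valence of a vertex. -/
def valence (v : V) : ℕ := graphValence T.src T.tgt T.leg v

/-- The over-valence `ov(v) = val(v) + 3 g(v) - 3` of a vertex. -/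
def overValence (v : V) : ℤ := (T.valence v : ℤ) + 3 * (T.vertexGenus v : ℤ) - 3

/-- The genus `b₁(Γ) + ∑ g(v)`, where `b₁(Γ) = #E - #V + 1` since `Γ` is connected. -/
def genus : ℤ :=
  ((Fintype.card E : ℤ) - (Fintype.card V : ℤ) + 1) + ∑ v, (T.vertexGenus v : ℤ)

/-- The degree `Δ(i) = w(E_i) u_i`. -/
def degree (i : I) : N := T.legWeight i • T.legDir i

/-- The expected dimension `#I + (r - 3)(1 - g) - ov(Γ)`. -/
def expectedDim : ℤ :=
  (Fintype.card I : ℤ) + ((Module.finrank ℤ N : ℤ) - 3) * (1 - T.genus) - ∑ v, T.overValence v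

/-- The face of the moduli space of all curves of type `T`, in terms of the vertex positions: each
compact edge is a positive multiple of its direction vector (and a point if that is zero). -/
def face : Set (V → RealSpace N) :=
  {p | ∀ e, ∃ c : ℝ, 0 < c ∧ p (T.tgt e) - p (T.src e) = c • toReal (T.edgeDir e)}

/-- No cycle of `T` consists of contracted edges. -/
def NoContractedLoop : Prop :=
  ∀ e, T.edgeWeight e = 0 →
    ¬ Relation.EqvGen
      (fun x y => ∃ e', e' ≠ e ∧ T.edgeWeight e' = 0 ∧ T.src e' = x ∧ T.tgt e' = y)
      (T.src e) (T.tgt e)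

/-- Non-superabundancy: no contracted loops, no vertices of positive genus, and the face has the
expected dimension (the dimension of a polyhedron being that of its affine span). -/
def NonSuperabundant : Prop :=
  T.NoContractedLoop ∧ (∀ v, T.vertexGenus v = 0) ∧
    (Module.finrank ℝ (vectorSpan ℝ T.face) : ℤ) = T.expectedDim

/-- The `ψ`-class conditions `s`, a tuple indexed by the contracted legs. -/
def SatisfiesPsi (s : {i : I // T.legWeight i = 0} → ℕ) : Prop :=
  ∀ v, ∑ i : {i : I // T.legWeight i = 0}, (if T.leg i = v then (s i : ℤ) else 0)
    ≤ T.overValence v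

end TropicalType

variable (N I V E) in
/-- A tropical curve: a type together with the positions `h(v)` of the vertices. -/
structure TropicalCurve extends TropicalType N I V E where
  /-- the position of a vertex -/
  pos : V → RealSpace N
  pos_mem : pos ∈ toTropicalType.face

variable (N I) in
/-- Affine constraints of rational slope, with positive integral weights. -/
structure AffineConstraint where
  /-- the affine subspace `A_i` -/
  space : I → AffineSubspace ℝ (RealSpace N)
  /-- the weight `w_i` -/
  weight : I → ℕ
  rational : ∀ i, IsRational (space i).direction
  weight_pos : ∀ i, 0 < weight i

/-- The codimension of `A_i`. -/
def AffineConstraint.codim (A : AffineConstraint N I) (i : I) : ℕ :=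
  Module.finrank ℝ (RealSpace N ⧸ (A.space i).direction)

/-- The positions `p` of the vertices of curves of type `T` that match the constraints: the ray
`h(E_i) = p(∂E_i) + ℝ_{≥0} u_i` lies in `A_i` for all `i`. -/
def TropicalType.constrainedFace (T : TropicalType N I V E) (A : AffineConstraint N I) :
    Set (V → RealSpace N) :=
  {p | p ∈ T.face ∧
    ∀ (i : I) (t : ℝ), 0 ≤ t → p (T.leg i) + t • toReal (T.legDir i) ∈ A.space i}

namespace TropicalCurve

variable (Γ : TropicalCurve N I V E) (A : AffineConstraint N I)

/-- The curve matches the constraints. -/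
def Matches : Prop := Γ.pos ∈ Γ.constrainedFace A

/-- The curve is an isolated point among the curves of its type that match the constraints. (The
set of these is convex, so that it has an isolated point only if it is a single point.) -/
def IsIsolated : Prop := Γ.constrainedFace A = {Γ.pos}

/-- The map
`Φ : ∏_v N → ∏_E N / (ℝ u_E ∩ N) × ∏_i N / (L(A_i) ∩ N)`,
`H ↦ ((H_{∂⁺E} - H_{∂⁻E})_E, (H_{∂E_i})_i)`. -/
def Phi : (V → N) →ₗ[ℤ]
    ((e : E) → N ⧸ latticePoints (Submodule.span ℝ {toReal (Γ.edgeDir e)})) ×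
      ((i : I) → N ⧸ latticePoints (A.space i).direction) :=
  LinearMap.prod
    (LinearMap.pi fun e =>
      (latticePoints (Submodule.span ℝ {toReal (Γ.edgeDir e)})).mkQ ∘ₗ
        ((LinearMap.proj (Γ.src e) : (V → N) →ₗ[ℤ] N) - LinearMap.proj (Γ.tgt e)))
    (LinearMap.pi fun i =>
      (latticePoints (A.space i).direction).mkQ ∘ₗ LinearMap.proj (Γ.leg i))

/-- The index of the image of `Φ` (with the convention that an infinite index counts as `0`). -/
def latticeIndex : ℕ := (LinearMap.range (Γ.Phi A)).toAddSubgroup.index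

/-- The multiplicity `Mult(Γ) = index(Φ) ∏_E w(E)`, the product being over compact edges. -/
def mult : ℕ := Γ.latticeIndex A * ∏ e, Γ.edgeWeight e

end TropicalCurve

/-! ### Polyvector fields and brackets -/

variable (N) in
/-- The exterior algebra `Λ* M` of the dual lattice. -/
abbrev DualExt : Type _ := ExteriorAlgebra ℤ (DualLattice N)

variable (N) in
/-- The algebra `ℤ[N] ⊗ Λ* M`, with `(z^n ⊗ α)(z^m ⊗ β) = z^(n+m) ⊗ (α ∧ β)`. -/
abbrev Polyvector : Type _ := AddMonoidAlgebra ℤ N ⊗[ℤ] DualExt N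

/-- The contraction `ι_n α`. -/
def contract (n : N) : DualExt N →ₗ[ℤ] DualExt N :=
  CliffordAlgebra.contractLeft (Module.Dual.eval ℤ N n)

/-- The element `z^n ⊗ α`. -/
def zmon (n : N) (α : DualExt N) : Polyvector N := AddMonoidAlgebra.single n (1 : ℤ) ⊗ₜ[ℤ] α

/-- `ℓ₁(z^n α) = z^n ι_n(α)`. -/
def ellOne : Polyvector N →ₗ[ℤ] Polyvector N :=
  TensorProduct.lift
    (Finsupp.linearCombination ℤ (fun n : N =>
        TensorProduct.mk ℤ (AddMonoidAlgebra ℤ N) (DualExt N)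
          (AddMonoidAlgebra.single n (1 : ℤ)) ∘ₗ contract n)
      ∘ₗ (AddMonoidAlgebra.coeffLinearEquiv ℤ).toLinearMap)

/-- The brackets `ℓ_k(ζ₁, …, ζ_k) = ℓ₁(ζ₁ ⋯ ζ_k)`. -/
def ell (k : ℕ) (ζ : Fin k → Polyvector N) : Polyvector N := ellOne (List.ofFn ζ).prod

theorem ellOne_zmon (n : N) (α : DualExt N) : ellOne (zmon n α) = zmon n (contract n α) := by
  refine (TensorProduct.lift.tmul _ _).trans ?_
  change Finsupp.linearCombination ℤ (fun n : N =>
        TensorProduct.mk ℤ (AddMonoidAlgebra ℤ N) (DualExt N)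
          (AddMonoidAlgebra.single n (1 : ℤ)) ∘ₗ contract n) (Finsupp.single n (1 : ℤ)) α = _
  rw [Finsupp.linearCombination_single, one_smul]
  rfl

theorem zmon_mul_zmon (n m : N) (α β : DualExt N) :
    zmon n α * zmon m β = zmon (n + m) (α * β) := by
  simp [zmon, AddMonoidAlgebra.single_mul_single]

theorem list_prod_zmon (l : List (N × DualExt N)) :
    (l.map fun x => zmon x.1 x.2).prod = zmon (l.map Prod.fst).sum (l.map Prod.snd).prod := by
  induction l with
  | nil => simp [zmon, Algebra.TensorProduct.one_def, AddMonoidAlgebra.one_def]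
  | cons a l ih => simp [ih, zmon_mul_zmon]

theorem ell_zmon (k : ℕ) (n : Fin k → N) (α : Fin k → DualExt N) :
    ell k (fun j => zmon (n j) (α j)) =
      zmon (∑ j, n j) (contract (∑ j, n j) (List.ofFn α).prod) := by
  have h := list_prod_zmon (List.ofFn fun j => (n j, α j))
  simp only [List.map_ofFn, Function.comp_def, List.sum_ofFn] at h
  rw [ell, h, ellOne_zmon]

/-- `α` is an element `α_{A_i}`: it has degree `codim A_i`, its index is the weight of `A_i`, and it
vanishes along the linear space parallel to `A_i`. -/
def AffineConstraint.IsForm (A : AffineConstraint N I) (i : I)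
    (α : ⋀[ℤ]^(A.codim i) (DualLattice N)) : Prop :=
  HasIndex α (A.weight i) ∧
    ∀ n ∈ latticePoints (A.space i).direction, contract n (α : DualExt N) = 0

/-! ### Flows and the elements `ζ_E` -/

/-- A flow towards `vinf`: an acyclic orientation of the compact edges (the legs flow inwards) with
`vinf` as its only sink. -/
structure Flow (T : TropicalType N I V E) (vinf : V) where
  /-- the vertex from which a compact edge flows -/
  tail : E → V
  /-- the vertex into which a compact edge flows -/
  head : E → V
  /-- whether the edge is oriented from `∂⁺` to `∂⁻` -/
  forward : E → Bool
  tail_eq : ∀ e, tail e = if forward e then T.src e else T.tgt e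
  head_eq : ∀ e, head e = if forward e then T.tgt e else T.src e
  acyclic : ∀ v, ¬ Relation.TransGen (fun a b => ∃ e, tail e = a ∧ head e = b) v v
  sink : ∀ v, (∀ e, tail e ≠ v) ↔ v = vinf

namespace Flow

variable {T : TropicalType N I V E} {vinf : V} (F : Flow T vinf)

/-- The vertex into which an edge (compact, or a leg) flows. -/
def target : E ⊕ I → V := Sum.elim F.head T.leg

/-- The edges (compact edges and legs) flowing into `v`. -/
abbrev Incoming (v : V) : Type _ := {x : E ⊕ I // F.target x = v}

/-- The weighted direction of an edge, pointing opposite to the flow. -/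
def direction : E ⊕ I → N :=
  Sum.elim
    (fun e => if F.forward e then T.edgeWeight e • -T.edgeDir e else T.edgeWeight e • T.edgeDir e)
    T.degree

/-- `ζ` is a family of elements obtained by the inductive rule: `z^{Δ(i)} ⊗ α_{A_i}` on the legs, and
on a compact edge flowing out of `v` the bracket of the elements of the edges flowing into `v`, in
some enumeration. -/
def IsZeta (A : AffineConstraint N I) (ζ : E ⊕ I → Polyvector N) : Prop :=
  (∀ i, ∃ α : ⋀[ℤ]^(A.codim i) (DualLattice N),
      A.IsForm i α ∧ ζ (Sum.inr i) = zmon (T.degree i) (α : DualExt N)) ∧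
    ∀ e, ∃ (k : ℕ) (σ : Fin k ≃ F.Incoming (F.tail e)),
      ζ (Sum.inl e) = ell k (fun j => ζ (σ j))

end Flow

/-- The edges (compact edges and legs) containing a vertex. -/
abbrev TropicalType.EdgesAt (T : TropicalType N I V E) (v : V) : Type _ :=
  {x : E ⊕ I // Sum.elim (fun e => T.src e = v ∨ T.tgt e = v) (fun i => T.leg i = v) x}

end TropicalCurves

end

/-! Since the genus is zero and the vertex genera vanish, the graph is a tree, and the flow roots it
at `V_∞`: every other vertex has exactly one outgoing edge. Vertex positions compatible with the
edge directions amount to the position `m` of the root and a length `t e` for each compact edge; the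
vertex `v` then sits at `m` plus the sum of `t e • u e` over the path from `v` to the root
(`posMap`). The edge components of `Φ` are surjective and their kernel is the image of this
parametrization (`ker_edgePhi`), so the index of `Φ` is that of `legMap`, from `N × ℤ^E` to `∏ N /
(L(A_i) ∩ N)` (`latticeIndex_eq`). As the codimensions sum to `r + #E`, the matrix of `legMap` is
square and the index is the absolute value of its determinant `legDet`. Passing to weighted
directions multiplies it by `∏ w(E)` (`legDet_smul`), which gives `Mult(Γ)`.

The determinant is then computed twice in the exterior algebra of the dual of `N × ℤ^E`, from the
product of the forms of the constraints, each pulled back along the position of the vertex of its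
leg. On the one hand this product is the determinant times a volume form; contracting by all edge
unit vectors and restricting to `N` leaves the determinant times the volume form of `N`
(`contrList_prod_primitiveForm`). On the other hand one contracts edge by edge in the order of the
flow (`exists_contrList_aux`). At the turn of `e`, only the factors sitting at its tail depend on `t
e`, and their product is replaced by its contraction by `u e`, which is the form of the edge `e` up
to sign. Being killed by `u e`, this form has the same pullback from both ends of `e` and moves to
the head. In the end all factors sit at `V_∞`, and their product is the product of the forms of the
`ζ_E`. Balancing takes care of the exponents, and the weights `w_i` factor out.

For an isolated curve, a kernel vector of `Φ` would be a deformation, so `Φ` is injective.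
Non-superabundancy rules out edges of direction zero (`edgeDir_ne_zero`), so `legMap` is injective
too and the index is finite. -/

namespace ExteriorAlgebra

open CliffordAlgebra (contractLeft)

/-! ### Contraction in an exterior algebra. -/

section Contraction

variable {R X Y : Type*} [CommRing R] [AddCommGroup X] [Module R X] [AddCommGroup Y] [Module R Y]

/-- Contraction of an element of the exterior algebra by a linear functional. -/
abbrev contr (d : Module.Dual R X) : ExteriorAlgebra R X →ₗ[R] ExteriorAlgebra R X :=
  contractLeft d

theorem contr_ι_mul (d : Module.Dual R X) (x : X) (a : ExteriorAlgebra R X) :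
    contr d (ι R x * a) = d x • a - ι R x * contr d a :=
  CliffordAlgebra.contractLeft_ι_mul (Q := (0 : QuadraticForm R X)) (d := d) x a

theorem contr_algebraMap (d : Module.Dual R X) (r : R) :
    contr d (algebraMap R (ExteriorAlgebra R X) r) = 0 :=
  CliffordAlgebra.contractLeft_algebraMap (Q := (0 : QuadraticForm R X)) (d := d) r

theorem contr_contr (d : Module.Dual R X) (a : ExteriorAlgebra R X) : contr d (contr d a) = 0 :=
  CliffordAlgebra.contractLeft_contractLeft (Q := (0 : QuadraticForm R X)) (d := d) a

theorem left_induction {P : ExteriorAlgebra R X → Prop}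
    (algebraMap : ∀ r : R, P (algebraMap R (ExteriorAlgebra R X) r))
    (add : ∀ a b, P a → P b → P (a + b)) (ι_mul : ∀ a x, P a → P (ι R x * a)) (a) : P a :=
  CliffordAlgebra.left_induction (Q := (0 : QuadraticForm R X)) algebraMap add ι_mul a

/-- Only the term of the antiderivation rule without a sign survives, so `a` need not be
homogeneous. -/
theorem contr_mul_of_right {d : Module.Dual R X} {b : ExteriorAlgebra R X} (hb : contr d b = 0)
    (a : ExteriorAlgebra R X) : contr d (a * b) = contr d a * b := by
  induction a using left_induction with
  | algebraMap r => rw [contr_algebraMap, zero_mul, ← Algebra.smul_def, map_smul, hb, smul_zero]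
  | add a a' h h' => rw [add_mul, map_add, h, h', map_add, add_mul]
  | ι_mul a x h => rw [mul_assoc, contr_ι_mul, h, contr_ι_mul, sub_mul, smul_mul_assoc, mul_assoc]

theorem contr_list_prod_eq_zero {d : Module.Dual R X} {l : List (ExteriorAlgebra R X)}
    (h : ∀ a ∈ l, contr d a = 0) : contr d l.prod = 0 := by
  induction l with
  | nil => simp
  | cons a l ih =>
    rw [List.prod_cons, contr_mul_of_right (ih fun b hb => h b (by simp [hb])), h a (by simp),
      zero_mul]

theorem contr_map (f : X →ₗ[R] Y) (d : Module.Dual R Y) (a : ExteriorAlgebra R X) :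
    contr d (map f a) = map f (contr (d ∘ₗ f) a) := by
  induction a using left_induction with
  | algebraMap r => rw [AlgHom.commutes, contr_algebraMap, contr_algebraMap, map_zero]
  | add a a' h h' => simp only [map_add, h, h']
  | ι_mul a x h =>
    rw [map_mul, map_apply_ι, contr_ι_mul, h, contr_ι_mul, map_sub, map_smul, map_mul, map_apply_ι]
    rfl

/-- In a monomial the perturbation can act on at most one factor, because `ι R y` squares to zero;
moving `ι R y` to the front produces exactly the signs of the contraction. -/
theorem map_add_smulRight (f : X →ₗ[R] Y) (d : Module.Dual R X) (y : Y)
    (a : ExteriorAlgebra R X) :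
    map (f + d.smulRight y) a = map f a + ι R y * map f (contr d a) := by
  induction a using left_induction with
  | algebraMap r => simp
  | add a a' h h' => simp only [map_add, h, h', mul_add]; abel
  | ι_mul a x h =>
    have h2 : ι R (f x) * ι R y = -(ι R y * ι R (f x)) :=
      eq_neg_of_add_eq_zero_left (ι_add_mul_swap _ _)
    have h3 : ι R (f x) * (ι R y * map f (contr d a)) =
        -(ι R y * (ι R (f x) * map f (contr d a))) := by
      rw [← mul_assoc, h2, neg_mul, mul_assoc]
    have h4 : ι R y * (ι R y * map f (contr d a)) = 0 := by
      rw [← mul_assoc, ι_sq_zero, zero_mul]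
    rw [map_mul, map_apply_ι, h, contr_ι_mul, map_mul, map_apply_ι, map_sub, map_smul, map_mul,
      map_apply_ι, LinearMap.add_apply, map_add, LinearMap.smulRight_apply, map_smul]
    simp only [add_mul, mul_add, h3, smul_mul_assoc, h4, smul_zero, mul_sub, mul_smul_comm]
    abel

/-- Used to move a form from one end of an edge to the other, and to show that forms killed by a
sublattice come from the quotient. -/
theorem map_add_smulRight_of_contr (f : X →ₗ[R] Y) {d : Module.Dual R X} (y : Y)
    {a : ExteriorAlgebra R X} (h : contr d a = 0) : map (f + d.smulRight y) a = map f a := by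
  rw [map_add_smulRight, h, map_zero, mul_zero, add_zero]

/-- Iterated contraction; the first functional of the list acts first. -/
def contrList (l : List (Module.Dual R X)) : ExteriorAlgebra R X →ₗ[R] ExteriorAlgebra R X :=
  l.foldr (fun d g => g ∘ₗ contr d) LinearMap.id

theorem contrList_nil (a : ExteriorAlgebra R X) : contrList [] a = a := rfl

theorem contrList_cons (d : Module.Dual R X) (l : List (Module.Dual R X))
    (a : ExteriorAlgebra R X) : contrList (d :: l) a = contrList l (contr d a) := rfl

/-- Contracting a product of generators by the dual family in the same order. -/
theorem contrList_ι_prod_mul (l : List (Module.Dual R X × X)) (c : ExteriorAlgebra R X)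
    (h1 : ∀ p ∈ l, p.1 p.2 = 1) (h0 : l.Pairwise fun p q => p.1 q.2 = 0)
    (hc : ∀ p ∈ l, contr p.1 c = 0) :
    contrList (l.map Prod.fst) ((l.map fun p => ι R p.2).prod * c) = c := by
  induction l with
  | nil => simp [contrList_nil]
  | cons p l ih =>
    rw [List.pairwise_cons] at h0
    have hz : contr p.1 ((l.map fun p => ι R p.2).prod * c) = 0 := by
      rw [contr_mul_of_right (hc p (by simp)), contr_list_prod_eq_zero, zero_mul]
      simp only [List.mem_map, forall_exists_index, and_imp]
      rintro _ q hq rfl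
      have := CliffordAlgebra.contractLeft_ι (Q := (0 : QuadraticForm R X)) p.1 q.2
      rw [h0.1 q hq, map_zero] at this
      exact this
    rw [List.map_cons, List.map_cons, contrList_cons, List.prod_cons, mul_assoc, contr_ι_mul, hz,
      mul_zero, sub_zero, h1 p (by simp), one_smul]
    exact ih (fun q hq => h1 q (by simp [hq])) h0.2 fun q hq => hc q (by simp [hq])

end Contraction

/-! ### Homogeneous elements and graded commutativity. -/

section Homogeneous

variable {R X Y : Type*} [CommRing R] [AddCommGroup X] [Module R X] [AddCommGroup Y] [Module R Y]

theorem ι_mem (x : X) : ι R x ∈ ⋀[R]^1 X := by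
  rw [exteriorPower, pow_one]; exact LinearMap.mem_range_self _ _

theorem mul_mem {m n : ℕ} {a b : ExteriorAlgebra R X} (ha : a ∈ ⋀[R]^m X) (hb : b ∈ ⋀[R]^n X) :
    a * b ∈ ⋀[R]^(m + n) X := by
  rw [exteriorPower, pow_add]; exact Submodule.mul_mem_mul ha hb

theorem exteriorPower_induction {P : ∀ n : ℕ, ExteriorAlgebra R X → Prop}
    (algebraMap : ∀ r : R, P 0 (algebraMap R (ExteriorAlgebra R X) r))
    (add : ∀ n a b, P n a → P n b → P n (a + b))
    (ι_mul : ∀ n a x, a ∈ ⋀[R]^n X → P n a → P (n + 1) (ι R x * a))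
    {n : ℕ} {a : ExteriorAlgebra R X} (ha : a ∈ ⋀[R]^n X) : P n a := by
  refine Submodule.pow_induction_on_left' (LinearMap.range (ι R : X →ₗ[R] _))
    (C := fun n a _ => P n a) algebraMap (fun a b n _ _ => add n a b) ?_ ha
  rintro _ ⟨x, rfl⟩ n a ha h
  exact ι_mul n a x ha h

theorem contr_mem (d : Module.Dual R X) {n : ℕ} {a : ExteriorAlgebra R X} (ha : a ∈ ⋀[R]^n X) :
    contr d a ∈ ⋀[R]^(n - 1) X := by
  -- The induction must carry the vanishing in degree `0`: with truncated subtraction, membership in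
  -- degree `0 - 1 = 0` would put `ι R x * contr d a` in degree `1` instead of `0`.
  have : ∀ {n : ℕ} {a : ExteriorAlgebra R X}, a ∈ ⋀[R]^n X →
      (n = 0 ∧ contr d a = 0) ∨ (n ≠ 0 ∧ contr d a ∈ ⋀[R]^(n - 1) X) := by
    intro n a ha
    refine exteriorPower_induction (P := fun n a => (n = 0 ∧ contr d a = 0) ∨
      (n ≠ 0 ∧ contr d a ∈ ⋀[R]^(n - 1) X)) (fun r => Or.inl ⟨rfl, contr_algebraMap d r⟩) ?_ ?_ ha
    · rintro n a b (⟨rfl, h⟩ | ⟨hn, h⟩) (⟨hn', h'⟩ | ⟨hn', h'⟩)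
      · exact Or.inl ⟨rfl, by rw [map_add, h, h', add_zero]⟩
      · exact absurd rfl hn'
      · exact absurd hn' hn
      · exact Or.inr ⟨hn, by rw [map_add]; exact add_mem h h'⟩
    · rintro n a x ha h
      refine Or.inr ⟨n.succ_ne_zero, ?_⟩
      rw [contr_ι_mul, Nat.add_sub_cancel]
      refine sub_mem (Submodule.smul_mem _ _ ha) ?_
      rcases h with ⟨rfl, h⟩ | ⟨hn, h⟩
      · rw [h, mul_zero]; exact zero_mem _
      · have := mul_mem (ι_mem x) h
        rwa [Nat.add_sub_cancel' (by omega)] at this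
  rcases this ha with ⟨rfl, h⟩ | ⟨_, h⟩
  · rw [h]; exact zero_mem _
  · exact h

theorem map_mem (f : X →ₗ[R] Y) {n : ℕ} {a : ExteriorAlgebra R X} (ha : a ∈ ⋀[R]^n X) :
    map f a ∈ ⋀[R]^n Y := by
  refine exteriorPower_induction (P := fun n a => map f a ∈ ⋀[R]^n Y) ?_ ?_ ?_ ha
  · intro r
    rw [AlgHom.commutes, exteriorPower, pow_zero]
    exact Submodule.algebraMap_mem r
  · intro n a b h h'
    rw [map_add]; exact add_mem h h'
  · intro n a x _ h
    rw [map_mul, map_apply_ι, add_comm]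
    exact mul_mem (ι_mem _) h

theorem map_coe (f : X →ₗ[R] Y) {n : ℕ} (a : ⋀[R]^n X) :
    map f (a : ExteriorAlgebra R X) = (exteriorPower.map n f a : ExteriorAlgebra R Y) := by
  have : (map f).toLinearMap ∘ₗ (⋀[R]^n X).subtype =
      (⋀[R]^n Y).subtype ∘ₗ exteriorPower.map n f := by
    apply exteriorPower.linearMap_ext
    ext v
    simp [map_apply_ιMulti]
  exact LinearMap.congr_fun this a

theorem mul_ι_comm {n : ℕ} {a : ExteriorAlgebra R X} (ha : a ∈ ⋀[R]^n X) (x : X) :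
    a * ι R x = (-1) ^ n * (ι R x * a) := by
  refine exteriorPower_induction (P := fun n a => a * ι R x = (-1) ^ n * (ι R x * a)) ?_ ?_ ?_ ha
  · intro r; simp [Algebra.commutes]
  · intro n a b h h'; rw [add_mul, h, h', mul_add, mul_add]
  · intro n a y _ h
    have h2 : ι R y * ι R x = -(ι R x * ι R y) :=
      eq_neg_of_add_eq_zero_left (ι_add_mul_swap _ _)
    have hc : ι R y * (-1) ^ n = (-1) ^ n * ι R y :=
      ((Commute.neg_one_right (ι R y)).pow_right n).eq
    rw [mul_assoc, h, ← mul_assoc, hc, mul_assoc, ← mul_assoc (ι R y), h2, pow_succ]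
    simp [mul_assoc]

theorem mul_comm_of_mem {m n : ℕ} {a b : ExteriorAlgebra R X} (ha : a ∈ ⋀[R]^m X)
    (hb : b ∈ ⋀[R]^n X) : a * b = (-1) ^ (m * n) * (b * a) := by
  refine exteriorPower_induction
    (P := fun m a => a * b = (-1) ^ (m * n) * (b * a)) ?_ ?_ ?_ ha
  · intro r; simp [Algebra.commutes]
  · intro n a b h h'; rw [add_mul, h, h', mul_add, mul_add]
  · intro m a x _ h
    have hc : ∀ k, ι R x * (-1) ^ k = (-1) ^ k * ι R x := fun k =>
      ((Commute.neg_one_right (ι R x)).pow_right k).eq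
    rw [mul_assoc, h, ← mul_assoc, hc, ← mul_assoc b, mul_ι_comm hb, Nat.succ_mul, pow_add,
      mul_assoc, mul_assoc, mul_assoc ((-1) ^ n), ← mul_assoc _ _ (ι R x * b * a),
      ← mul_assoc _ _ (ι R x * b * a), ← pow_add, ← pow_add, mul_assoc]
    congr 1
    rw [pow_add, ← two_mul, pow_mul]
    simp

end Homogeneous
end ExteriorAlgebra

/-! ### Equality up to sign -/

/-- Equality up to sign. -/
def EqSign {A : Type*} [AddCommGroup A] (a b : A) : Prop := b = a ∨ b = -a

namespace EqSign

variable {A B : Type*} [AddCommGroup A] [AddCommGroup B] {a b c : A}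

theorem refl (a : A) : EqSign a a := Or.inl rfl

theorem symm (h : EqSign a b) : EqSign b a := by
  rcases h with rfl | rfl
  · exact Or.inl rfl
  · exact Or.inr (neg_neg a).symm

theorem trans (h : EqSign a b) (h' : EqSign b c) : EqSign a c := by
  rcases h with rfl | rfl <;> rcases h' with rfl | rfl
  · exact Or.inl rfl
  · exact Or.inr rfl
  · exact Or.inr rfl
  · exact Or.inl (neg_neg a)

theorem map {F : Type*} [FunLike F A B] [AddMonoidHomClass F A B] (f : F) (h : EqSign a b) :
    EqSign (f a) (f b) := by
  rcases h with rfl | rfl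
  · exact Or.inl rfl
  · exact Or.inr (map_neg f a)

theorem mul {A : Type*} [Ring A] {a b a' b' : A} (h : EqSign a b) (h' : EqSign a' b') :
    EqSign (a * a') (b * b') := by
  rcases h with rfl | rfl <;> rcases h' with rfl | rfl
  · exact Or.inl rfl
  · exact Or.inr (mul_neg _ _)
  · exact Or.inr (neg_mul _ _)
  · exact Or.inl (neg_mul_neg _ _)

theorem list_prod {A : Type*} [Ring A] {α : Type*} {f g : α → A} {l : List α}
    (h : ∀ x ∈ l, EqSign (f x) (g x)) : EqSign (l.map f).prod (l.map g).prod := by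
  induction l with
  | nil => exact refl _
  | cons x l ih =>
    rw [List.map_cons, List.map_cons, List.prod_cons, List.prod_cons]
    exact (h x (by simp)).mul (ih fun y hy => h y (by simp [hy]))

theorem neg_one_pow_mul {A : Type*} [Ring A] (n : ℕ) (a : A) : EqSign a ((-1) ^ n * a) := by
  rcases neg_one_pow_eq_or A n with h | h
  · exact Or.inl (by rw [h, one_mul])
  · exact Or.inr (by rw [h, neg_one_mul])

end EqSign

namespace ExteriorAlgebra

/-! ### Independence of the order of factors up to sign. -/

section Homog

variable {R X Y : Type*} [CommRing R] [AddCommGroup X] [Module R X] [AddCommGroup Y] [Module R Y]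

/-- Homogeneous elements of the exterior algebra. -/
def IsHomog (a : ExteriorAlgebra R X) : Prop := ∃ n : ℕ, a ∈ ⋀[R]^n X

theorem IsHomog.one : IsHomog (1 : ExteriorAlgebra R X) :=
  ⟨0, by rw [exteriorPower, pow_zero]; exact Submodule.one_le.mp le_rfl⟩

theorem IsHomog.mul {a b : ExteriorAlgebra R X} : IsHomog a → IsHomog b → IsHomog (a * b) :=
  fun ⟨m, ha⟩ ⟨n, hb⟩ => ⟨m + n, mul_mem ha hb⟩

theorem IsHomog.contr {a : ExteriorAlgebra R X} (d : Module.Dual R X) :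
    IsHomog a → IsHomog (contr d a) :=
  fun ⟨m, ha⟩ => ⟨m - 1, contr_mem d ha⟩

theorem IsHomog.map {a : ExteriorAlgebra R X} (f : X →ₗ[R] Y) :
    IsHomog a → IsHomog (map f a) :=
  fun ⟨m, ha⟩ => ⟨m, map_mem f ha⟩

theorem IsHomog.list_prod {l : List (ExteriorAlgebra R X)} (h : ∀ a ∈ l, IsHomog a) :
    IsHomog l.prod := by
  induction l with
  | nil => exact IsHomog.one
  | cons a l ih =>
    rw [List.prod_cons]
    exact (h a (by simp)).mul (ih fun b hb => h b (by simp [hb]))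

theorem IsHomog.mul_comm {a b : ExteriorAlgebra R X} :
    IsHomog a → IsHomog b → EqSign (a * b) (b * a) := by
  rintro ⟨m, ha⟩ ⟨n, hb⟩
  rw [mul_comm_of_mem hb ha]
  exact EqSign.neg_one_pow_mul _ _

theorem list_prod_perm {l l' : List (ExteriorAlgebra R X)} (hl : l.Perm l')
    (h : ∀ a ∈ l, IsHomog a) : EqSign l.prod l'.prod := by
  induction hl with
  | nil => exact EqSign.refl _
  | cons a hp ih =>
    rw [List.prod_cons, List.prod_cons]
    exact (EqSign.refl _).mul (ih fun b hb => h b (by simp [hb]))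
  | swap a b l =>
    simp only [List.prod_cons, ← mul_assoc]
    exact ((h b (by simp)).mul_comm (h a (by simp))).mul (EqSign.refl _)
  | trans h₁ h₂ ih₁ ih₂ =>
    exact (ih₁ h).trans (ih₂ fun a ha => h a (h₁.mem_iff.mpr ha))

theorem map_prod_perm {α : Type*} {f : α → ExteriorAlgebra R X} {l l' : List α} (hl : l.Perm l')
    (h : ∀ x ∈ l, IsHomog (f x)) : EqSign (l.map f).prod (l'.map f).prod :=
  list_prod_perm (hl.map f) (by simpa using h)

end Homog

/-! ### Top-degree products as determinants. -/

section Top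

/-- A product of generators over an enumeration of the index type of a basis is the determinant
times the product of the basis vectors. -/
theorem list_prod_ι_eq_det_smul {R X J : Type*} [CommRing R] [AddCommGroup X] [Module R X]
    [Fintype J] [DecidableEq J] (e : Module.Basis J R X) (ψ : J → X) {l : List J}
    (hl : l.Nodup) (hmem : ∀ j, j ∈ l) :
    (l.map fun j => ι R (ψ j)).prod = e.det ψ • (l.map fun j => ι R (e j)).prod := by
  let q : Fin l.length ≃ J := hl.getEquivOfForallMemList l hmem
  have key : ∀ v : J → X, (l.map fun j => ι R (v j)).prod = (ιMulti R l.length).domDomCongr q v := by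
    intro v
    rw [AlternatingMap.domDomCongr_apply, ιMulti_apply]
    congr 1
    apply List.ext_get
    · simp
    · intro n h1 h2
      simp [q]
  let f : X [⋀^J]→ₗ[R] ExteriorAlgebra R X :=
    (LinearMap.toSpanSingleton R _ (l.map fun j => ι R (e j)).prod).compAlternatingMap e.det
  have h : (ιMulti R l.length).domDomCongr q = f := by
    -- Both sides are alternating, so they need only be compared on permutations of the basis, and
    -- hence on the basis itself.
    refine Module.Basis.ext_alternating e fun i hi => ?_
    let σ : Equiv.Perm J := Equiv.ofBijective i (Finite.injective_iff_bijective.1 hi)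
    change (ιMulti R l.length).domDomCongr q (e ∘ σ) = f (e ∘ σ)
    rw [AlternatingMap.map_perm, AlternatingMap.map_perm, ← key]
    simp [f, Module.Basis.det_self]
  rw [key, h]
  rfl

end Top

end ExteriorAlgebra

/-! ### Indices of images of lattice maps. -/

section Index

open Module

/-- The index of the image of a linear map between lattices of the same rank. -/
theorem index_range_eq_natAbs_det {X Y J : Type*} [AddCommGroup X] [AddCommGroup Y]
    [Fintype J] [DecidableEq J] (bX : Basis J ℤ X) (bY : Basis J ℤ Y) (f : X →ₗ[ℤ] Y) :
    (LinearMap.range f).toAddSubgroup.index = (bY.det (f ∘ bX)).natAbs := by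
  have hdet : bY.det (f ∘ bX) = (LinearMap.toMatrix bX bY f).det := by
    rw [Basis.det_apply]
    congr 1
    ext i j
    simp [Basis.toMatrix_apply, LinearMap.toMatrix_apply]
  by_cases hf : Function.Injective f
  · exact AddSubgroup.index_eq_natAbs_det bY (LinearMap.range f).toAddSubgroup
      (bX.map (LinearEquiv.ofInjective f hf))
  -- Without injectivity the determinant vanishes; the index is then infinite, which `index` records
  -- as `0`.
  · have h0 : bY.det (f ∘ bX) = 0 := by
      by_contra h
      apply hf
      rw [← LinearMap.ker_eq_bot, LinearMap.ker_eq_bot']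
      intro x hx
      have h1 : (LinearMap.toMatrix bX bY f).mulVec (bX.repr x) = 0 := by
        rw [LinearMap.toMatrix_mulVec_repr, hx, map_zero]; rfl
      have h2 := Matrix.eq_zero_of_mulVec_eq_zero (hdet ▸ h) h1
      exact bX.repr.map_eq_zero_iff.mp (DFunLike.coe_injective h2)
    rw [h0, Int.natAbs_zero]
    by_contra hn
    set n := (LinearMap.range f).toAddSubgroup.index with hndef
    have hmem : ∀ j, ∃ x, f x = n • bY j := fun j =>
      AddSubgroup.nsmul_index_mem (LinearMap.range f).toAddSubgroup (bY j)
    choose x hx using hmem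
    -- A finite index `n` kills the cokernel, so `f` has a right inverse up to the factor `n`;
    -- determinants then force a power of `n` to vanish.
    have hcomp : f ∘ₗ bY.constr ℤ x = (n : ℤ) • LinearMap.id := by
      refine bY.ext fun j => ?_
      simp [hx]
    have hm := congrArg (LinearMap.toMatrix bY bY) hcomp
    rw [LinearMap.toMatrix_comp bY bX bY, map_smul, LinearMap.toMatrix_id] at hm
    have hd := congrArg Matrix.det hm
    rw [Matrix.det_mul, ← hdet, h0, zero_mul, Matrix.det_smul, Matrix.det_one, mul_one] at hd
    exact hn (by exact_mod_cast eq_zero_of_pow_eq_zero hd.symm)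

theorem index_range_ne_zero {X Y J : Type*} [AddCommGroup X] [AddCommGroup Y]
    [Fintype J] [DecidableEq J] (bX : Basis J ℤ X) (bY : Basis J ℤ Y) {f : X →ₗ[ℤ] Y}
    (hf : Function.Injective f) : (LinearMap.range f).toAddSubgroup.index ≠ 0 := by
  rw [index_range_eq_natAbs_det bX bY, Int.natAbs_ne_zero]
  have hli : LinearIndependent ℤ (f ∘ bX) := bX.linearIndependent.map' f (LinearMap.ker_eq_bot.mpr hf)
  intro h
  obtain ⟨v, hv, hv'⟩ := Matrix.exists_mulVec_eq_zero_iff.mpr (bY.det_apply (f ∘ bX) ▸ h)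
  refine hv (funext fun j => ?_)
  refine Fintype.linearIndependent_iff.mp hli v ?_ j
  refine bY.repr.map_eq_zero_iff.mp (Finsupp.ext fun i => ?_)
  have := congrFun hv' i
  simp only [Matrix.mulVec, dotProduct, Basis.toMatrix_apply] at this
  simpa [mul_comm] using this

/-- The index of the image of a map to a product whose first component is surjective. -/
theorem index_range_prod {X Y Z : Type*} [AddCommGroup X] [AddCommGroup Y] [AddCommGroup Z]
    (f : X →ₗ[ℤ] Y) (g : X →ₗ[ℤ] Z) (hf : Function.Surjective f) :
    (LinearMap.range (f.prod g)).toAddSubgroup.index =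
      ((LinearMap.ker f).map g).toAddSubgroup.index := by
  have hcomap : (LinearMap.range (f.prod g)).toAddSubgroup.comap (AddMonoidHom.inr Y Z) =
      ((LinearMap.ker f).map g).toAddSubgroup := by
    ext z
    constructor
    · rintro ⟨x, hx⟩
      have := Prod.ext_iff.mp hx
      exact ⟨x, this.1, this.2⟩
    · rintro ⟨x, hx, rfl⟩
      exact ⟨x, Prod.ext hx rfl⟩
  -- By surjectivity of `f`, the image and the second factor generate the product, so the index may
  -- be computed inside the second factor.
  have htop : (AddMonoidHom.inr Y Z).range ⊔ (LinearMap.range (f.prod g)).toAddSubgroup = ⊤ := by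
    rw [eq_top_iff]
    rintro ⟨y, z⟩ -
    obtain ⟨x, rfl⟩ := hf y
    have : ((f x, z) : Y × Z) = (0, z - g x) + (f x, g x) := by simp
    rw [this]
    exact AddSubgroup.add_mem_sup ⟨z - g x, rfl⟩ ⟨x, rfl⟩
  rw [← hcomap, AddSubgroup.index_comap, ← AddSubgroup.relIndex_sup_right, htop,
    AddSubgroup.relIndex_top_right]

end Index

/-! ### Primitive vectors, rational subspaces and forms vanishing along them. -/

section

open ExteriorAlgebra Module

section Top

variable {R X : Type*} [CommRing R] [AddCommGroup X] [Module R X]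

theorem ExteriorAlgebra.ιMulti_eq_det_smul {n : ℕ} (e : Basis (Fin n) R X) (v : Fin n → X) :
    ιMulti R n v = e.det v • ιMulti R n e := by
  have h := list_prod_ι_eq_det_smul e v (List.nodup_finRange n) (List.mem_finRange)
  simpa only [ιMulti_apply, List.ofFn_eq_map] using h

/-- The top exterior power is spanned by the product of the vectors of a basis. -/
theorem exteriorPower.exists_eq_smul_ιMulti {n : ℕ} (e : Basis (Fin n) R X) (a : ⋀[R]^n X) :
    ∃ k : R, a = k • exteriorPower.ιMulti R n e := by
  have ha : a ∈ Submodule.span R (Set.range (exteriorPower.ιMulti R n (M := X))) := by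
    rw [exteriorPower.ιMulti_span]; trivial
  induction ha using Submodule.span_induction with
  | mem x hx =>
    obtain ⟨v, rfl⟩ := hx
    exact ⟨e.det v, Subtype.ext (by simpa using ιMulti_eq_det_smul e v)⟩
  | zero => exact ⟨0, (zero_smul _ _).symm⟩
  | add x y _ _ hx hy =>
    obtain ⟨k, rfl⟩ := hx
    obtain ⟨k', rfl⟩ := hy
    exact ⟨k + k', (add_smul _ _ _).symm⟩
  | smul r x _ hx =>
    obtain ⟨k, rfl⟩ := hx
    exact ⟨r * k, (mul_smul _ _ _).symm⟩

end Top

namespace TropicalCurves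

section Primitive

variable {L : Type*} [AddCommGroup L]

theorem IsPrimitive.of_functional {v : L} (f : L →ₗ[ℤ] ℤ) (hf : f v = 1) : IsPrimitive v := by
  rintro k v' rfl
  rw [map_nsmul, nsmul_eq_mul] at hf
  have := Int.eq_one_or_neg_one_of_mul_eq_one hf
  omega

theorem IsPrimitive.natAbs_eq_one {j : ℤ} {v : L} (h : IsPrimitive (j • v)) : j.natAbs = 1 := by
  rcases Int.natAbs_eq j with hj | hj
  · refine h _ v ?_
    conv_rhs => rw [hj]
    rw [natCast_zsmul]
  · refine h _ (-v) ?_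
    conv_rhs => rw [hj]
    rw [smul_neg, neg_smul, natCast_zsmul]

theorem eqSign_natAbs_smul (j : ℤ) (v : L) : EqSign (j.natAbs • v) (j • v) := by
  rcases Int.natAbs_eq j with hj | hj
  · left; conv_lhs => rw [hj]
    rw [natCast_zsmul]
  · right; conv_lhs => rw [hj]
    rw [neg_smul, natCast_zsmul]

theorem HasIndex.smul_of_functional {v : L} (f : L →ₗ[ℤ] ℤ) (hf : f v = 1) (j : ℤ) :
    HasIndex (j • v) j.natAbs := by
  rcases eqSign_natAbs_smul j v with h | h
  · exact ⟨v, .of_functional f hf, h⟩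
  · exact ⟨-v, .of_functional (-f) (by simp [hf]), by rw [h, smul_neg]⟩

/-- The functional shows that the primitive vector underlying `a` is itself an integral multiple of
`v`, and primitivity makes the coefficient `±1`. -/
theorem HasIndex.eqSign [IsAddTorsionFree L] {a v : L} {w : ℕ} (h : HasIndex a w) (hw : 0 < w)
    (f : L →ₗ[ℤ] ℤ) (hf : f v = 1) {k : ℤ} (hk : a = k • v) : EqSign (w • v) a := by
  obtain ⟨a', ha', rfl⟩ := h
  have h1 : (w : ℤ) * f a' = k := by
    have := congrArg f hk
    simpa [hf] using this
  have h2 : a' = f a' • v := by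
    apply nsmul_right_injective hw.ne'
    simp only
    rw [hk, ← h1, mul_smul, natCast_zsmul]
  rw [h2] at ha' ⊢
  have := eqSign_natAbs_smul (f a') v
  rw [ha'.natAbs_eq_one, one_smul] at this
  exact this.map (nsmulAddMonoidHom w)

end Primitive

section Forms

variable {N : Type*} [AddCommGroup N]

/-- The functionals on `N` induced by the coordinates of a basis of `N / L`. -/
noncomputable def quotCoord {L : Submodule ℤ N} {J : Type*} (b : Basis J ℤ (N ⧸ L)) (j : J) : DualLattice N :=
  b.coord j ∘ₗ L.mkQ

theorem quotCoord_apply_of_mem {L : Submodule ℤ N} {J : Type*} (b : Basis J ℤ (N ⧸ L)) (j : J)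
    {n : N} (hn : n ∈ L) : quotCoord b j n = 0 := by
  simp [quotCoord, (Submodule.Quotient.mk_eq_zero L).mpr hn]

theorem contract_eq (n : N) : contract n = contr (Dual.eval ℤ N n) := rfl

theorem contract_ιMulti_quotCoord {L : Submodule ℤ N} {c : ℕ} (b : Basis (Fin c) ℤ (N ⧸ L))
    {n : N} (hn : n ∈ L) :
    contract n (exteriorPower.ιMulti ℤ c (quotCoord b) : DualExt N) = 0 := by
  rw [exteriorPower.ιMulti_apply_coe, ιMulti_apply, contract_eq]
  apply contr_list_prod_eq_zero
  simp only [List.mem_ofFn, forall_exists_index]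
  rintro _ j rfl
  refine (CliffordAlgebra.contractLeft_ι (Q := (0 : QuadraticForm ℤ (DualLattice N))) _ _).trans ?_
  rw [Dual.eval_apply, quotCoord_apply_of_mem b j hn, map_zero]

/-- Pair with lifts of the basis vectors: the matrix of pairings is the identity. Through
`IsPrimitive.of_functional` this makes the product of the coordinates primitive. -/
theorem exists_functional_quotCoord {L : Submodule ℤ N} {c : ℕ} (b : Basis (Fin c) ℤ (N ⧸ L)) :
    ∃ f : ⋀[ℤ]^c (DualLattice N) →ₗ[ℤ] ℤ, f (exteriorPower.ιMulti ℤ c (quotCoord b)) = 1 := by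
  choose v hv using fun j => L.mkQ_surjective (b j)
  refine ⟨(exteriorPower.pairingDual ℤ N c).flip (exteriorPower.ιMulti ℤ c v), ?_⟩
  rw [LinearMap.flip_apply, exteriorPower.pairingDual_ιMulti_ιMulti]
  convert Matrix.det_one (n := Fin c) (R := ℤ)
  ext i j
  rw [Matrix.of_apply, quotCoord, LinearMap.comp_apply, hv, Matrix.one_apply]
  simp [Finsupp.single_apply]

theorem toReal_apply (n : N) : toReal n = (1 : ℝ) ⊗ₜ[ℤ] n := rfl

theorem toReal_injective [Module.Free ℤ N] :
    Function.Injective (toReal : N →ₗ[ℤ] RealSpace N) := by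
  have h := Module.Flat.rTensor_preserves_injective_linearMap (M := N)
    (Algebra.linearMap ℤ ℝ) (Int.cast_injective)
  intro x y hxy
  have := @h ((1 : ℤ) ⊗ₜ x) ((1 : ℤ) ⊗ₜ y) (by simpa [toReal_apply] using hxy)
  simpa using congrArg (TensorProduct.lid ℤ N) this

variable [Module.Free ℤ N] [Module.Finite ℤ N]

/-- A section `s` of `N → N ⧸ L` writes the identity of the dual lattice as `p`, which factors
through the dual of `N ⧸ L`, plus rank-one maps given by evaluation at vectors of `L`. A form killed
by `L` ignores the latter, so it is pulled back from `N ⧸ L`, where it has top degree. -/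
theorem exists_eq_smul_of_contract_eq_zero {L : Submodule ℤ N} {c : ℕ}
    (b : Basis (Fin c) ℤ (N ⧸ L)) (a : ⋀[ℤ]^c (DualLattice N))
    (ha : ∀ n ∈ L, contract n (a : DualExt N) = 0) :
    ∃ k : ℤ, a = k • exteriorPower.ιMulti ℤ c (quotCoord b) := by
  have : Module.Free ℤ (N ⧸ L) := Module.Free.of_basis b
  obtain ⟨s, hs⟩ := Module.projective_lifting_property L.mkQ LinearMap.id L.mkQ_surjective
  let bL := Module.Free.chooseBasis ℤ L
  have hmem : ∀ n, (LinearMap.id - s ∘ₗ L.mkQ : N →ₗ[ℤ] N) n ∈ L := by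
    intro n
    refine (Submodule.Quotient.mk_eq_zero L).mp ?_
    rw [← Submodule.mkQ_apply]
    have := LinearMap.congr_fun hs (L.mkQ n)
    simp only [LinearMap.comp_apply, LinearMap.id_apply] at this
    simp only [LinearMap.sub_apply, LinearMap.id_apply, LinearMap.comp_apply, map_sub, this,
      sub_self]
  let τ : Module.Free.ChooseBasisIndex ℤ L → DualLattice N := fun j =>
    bL.coord j ∘ₗ (LinearMap.id - s ∘ₗ L.mkQ : N →ₗ[ℤ] N).codRestrict L hmem
  let p : DualLattice N →ₗ[ℤ] DualLattice N := (s ∘ₗ L.mkQ).dualMap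
  have hsum : LinearMap.id = p + ∑ j, (Dual.eval ℤ N (bL j : N)).smulRight (τ j) := by
    ext m n
    have h1 := congrArg (fun x : L => m x)
      (bL.sum_repr ((LinearMap.id - s ∘ₗ L.mkQ : N →ₗ[ℤ] N).codRestrict L hmem n))
    simp only [Submodule.coe_sum, Submodule.coe_smul, map_sum, map_smul, LinearMap.codRestrict_apply,
      LinearMap.sub_apply, map_sub, LinearMap.id_apply] at h1
    simp only [LinearMap.id_apply, LinearMap.add_apply, LinearMap.sum_apply,
      LinearMap.smulRight_apply, LinearMap.smul_apply, p, LinearMap.dualMap_apply, τ,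
      LinearMap.comp_apply, Dual.eval_apply, Basis.coord_apply]
    simp only [LinearMap.comp_apply] at h1
    rw [← sub_eq_iff_eq_add', ← h1]
    exact Finset.sum_congr rfl fun j _ => mul_comm _ _
  have hmap : ∀ t : Finset (Module.Free.ChooseBasisIndex ℤ L),
      map (p + ∑ j ∈ t, (Dual.eval ℤ N (bL j : N)).smulRight (τ j)) (a : DualExt N) =
        map p (a : DualExt N) := by
    classical
    intro t
    induction t using Finset.induction_on with
    | empty => simp
    | insert j t hj ih =>
      rw [Finset.sum_insert hj, add_comm (LinearMap.smulRight _ _), ← add_assoc,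
        map_add_smulRight_of_contr _ _ (ha _ (bL j).2), ih]
  have hp : p = L.mkQ.dualMap ∘ₗ s.dualMap := by
    rw [LinearMap.dualMap_comp_dualMap]
  have h2 : (a : DualExt N) = map L.mkQ.dualMap (map s.dualMap (a : DualExt N)) := by
    rw [← AlgHom.comp_apply, map_comp_map, ← hp, ← hmap Finset.univ, ← hsum, map_id]
    rfl
  rw [map_coe] at h2
  obtain ⟨k, hk⟩ := exteriorPower.exists_eq_smul_ιMulti b.dualBasis (exteriorPower.map c s.dualMap a)
  refine ⟨k, Subtype.ext ?_⟩
  rw [h2, hk, map_coe, map_smul, exteriorPower.map_apply_ιMulti]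
  congr 4
  ext j
  simp [quotCoord]

/-- `W ∩ N` is saturated because one can divide by integers in `W`. Hence the quotient is free and
has a basis. -/
instance (W : Submodule ℝ (RealSpace N)) : IsAddTorsionFree (N ⧸ latticePoints W) := by
  refine ⟨fun k hk x y hxy => ?_⟩
  obtain ⟨x, rfl⟩ := Submodule.mkQ_surjective _ x
  obtain ⟨y, rfl⟩ := Submodule.mkQ_surjective _ y
  simp only [← map_nsmul] at hxy
  rw [← sub_eq_zero, ← map_sub, ← smul_sub, Submodule.mkQ_apply,
    Submodule.Quotient.mk_eq_zero] at hxy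
  rw [← sub_eq_zero, ← map_sub, Submodule.mkQ_apply, Submodule.Quotient.mk_eq_zero]
  have h : k • toReal (x - y) ∈ W := by
    rw [← map_nsmul]; exact hxy
  have h' := W.smul_mem (k : ℝ)⁻¹ h
  rwa [← Nat.cast_smul_eq_nsmul ℝ, inv_smul_smul₀ (Nat.cast_ne_zero.mpr hk)] at h'

/-- By flatness `ℝ ⊗ (W ∩ N)` embeds into `N_ℝ`, and rationality says that its image is `W`. -/
theorem finrank_latticePoints {W : Submodule ℝ (RealSpace N)} (hW : IsRational W) :
    finrank ℤ (latticePoints W) = finrank ℝ W := by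
  have hinj : Function.Injective ((latticePoints W).subtype.baseChange ℝ) :=
    Module.Flat.lTensor_preserves_injective_linearMap _ (Submodule.subtype_injective _)
  have hr : LinearMap.range ((latticePoints W).subtype.baseChange ℝ) = W := by
    refine Eq.trans ?_ hW
    apply le_antisymm
    · rintro _ ⟨x, rfl⟩
      induction x using TensorProduct.induction_on with
      | zero => rw [map_zero]; exact zero_mem _
      | add x y hx hy => rw [map_add]; exact add_mem hx hy
      | tmul r n =>
        have : (latticePoints W).subtype.baseChange ℝ (r ⊗ₜ n) = r • toReal (n : N) := by
          simp [toReal_apply, TensorProduct.smul_tmul']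
        rw [this]
        exact Submodule.smul_mem _ _ (Submodule.subset_span ⟨n, n.2, rfl⟩)
    · rw [Submodule.span_le]
      rintro _ ⟨n, hn, rfl⟩
      exact ⟨1 ⊗ₜ ⟨n, hn⟩, by simp [toReal_apply]⟩
  have h := (LinearEquiv.ofInjective _ hinj).finrank_eq
  rw [hr, Module.finrank_baseChange] at h
  exact h

theorem finrank_quotient_latticePoints {W : Submodule ℝ (RealSpace N)} (hW : IsRational W) :
    finrank ℤ (N ⧸ latticePoints W) = finrank ℝ (RealSpace N ⧸ W) := by
  have h1 := finrank_latticePoints hW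
  have h2 := Submodule.finrank_quotient_add_finrank W
  have h3 := Submodule.finrank_quotient_add_finrank (latticePoints W)
  rw [Module.finrank_baseChange, ← h3] at h2
  omega

/-- For primitive `u` the lattice `ℝu ∩ N` has rank one, and `u` is an integral multiple of a
generator; primitivity makes the factor `±1`. -/
theorem mem_latticePoints_span_singleton {u : N} (hu : IsPrimitive u ∨ u = 0) {n : N} :
    n ∈ latticePoints (Submodule.span ℝ {toReal u}) ↔ ∃ t : ℤ, t • u = n := by
  constructor
  swap
  · rintro ⟨t, rfl⟩
    change toReal (t • u) ∈ Submodule.span ℝ {toReal u}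
    rw [map_smul]
    exact zsmul_mem (Submodule.mem_span_singleton_self _) t
  intro hn
  rcases hu with hu | rfl
  · set W := Submodule.span ℝ {toReal u} with hWdef
    have hu0 : u ≠ 0 := by
      rintro rfl
      exact absurd (hu 0 0 (by simp)) (by simp)
    have huW : u ∈ latticePoints W := Submodule.mem_span_singleton_self _
    have hW : IsRational W := by
      apply le_antisymm
      · rw [Submodule.span_le]
        rintro _ ⟨m, hm, rfl⟩
        exact hm
      · rw [hWdef, Submodule.span_le, Set.singleton_subset_iff]
        exact Submodule.subset_span ⟨u, huW, rfl⟩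
    have h1 : finrank ℤ (latticePoints W) = 1 := by
      rw [finrank_latticePoints hW, hWdef]
      exact finrank_span_singleton fun h => hu0 (toReal_injective (h.trans (map_zero _).symm))
    let b := Module.finBasisOfFinrankEq ℤ _ h1
    have hb : ∀ m : latticePoints W, ∃ t : ℤ, (m : N) = t • (b 0 : N) := by
      intro m
      refine ⟨b.repr m 0, ?_⟩
      conv_lhs => rw [← b.sum_repr m]
      simp
    obtain ⟨k, hk⟩ := hb ⟨u, huW⟩
    obtain ⟨t, ht⟩ := hb ⟨n, hn⟩
    simp only at hk ht
    have hk1 : k * k = 1 := by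
      rw [hk] at hu
      rw [← Int.natAbs_mul_self, hu.natAbs_eq_one]
      rfl
    exact ⟨t * k, by rw [hk, smul_smul, mul_assoc, hk1, mul_one, ht]⟩
  · refine ⟨0, ?_⟩
    have : toReal n ∈ Submodule.span ℝ {toReal (0 : N)} := hn
    rw [map_zero, Submodule.span_zero_singleton, Submodule.mem_bot] at this
    rw [zero_smul]
    exact (toReal_injective (this.trans (map_zero _).symm)).symm

/-- A basis of `N / (W ∩ N)`. -/
noncomputable def quotBasis {W : Submodule ℝ (RealSpace N)} (hW : IsRational W) :
    Basis (Fin (finrank ℝ (RealSpace N ⧸ W))) ℤ (N ⧸ latticePoints W) :=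
  Module.finBasisOfFinrankEq ℤ _ (finrank_quotient_latticePoints hW)

variable {I : Type*}

namespace AffineConstraint

variable (A : AffineConstraint N I) (i : I)

/-- A basis of the lattice of translates of the constraint. -/
noncomputable def basis : Basis (Fin (A.codim i)) ℤ (N ⧸ latticePoints (A.space i).direction) :=
  quotBasis (A.rational i)

/-- Functionals on `N` which form a basis of those vanishing along the constraint. -/
noncomputable def functional (k : Fin (A.codim i)) : DualLattice N :=
  quotCoord (A.basis i) k

/-- The product of the functionals vanishing along the constraint. -/
noncomputable def primitiveForm : ⋀[ℤ]^(A.codim i) (DualLattice N) :=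
  exteriorPower.ιMulti ℤ _ (A.functional i)

variable {A i}

theorem IsForm.eqSign {α : ⋀[ℤ]^(A.codim i) (DualLattice N)} (h : A.IsForm i α) :
    EqSign (A.weight i • A.primitiveForm i) α := by
  obtain ⟨k, hk⟩ := exists_eq_smul_of_contract_eq_zero (A.basis i) α h.2
  obtain ⟨f, hf⟩ := exists_functional_quotCoord (A.basis i)
  have : IsAddTorsionFree (⋀[ℤ]^(A.codim i) (DualLattice N)) :=
    Module.isTorsionFree_int_iff_isAddTorsionFree.mp inferInstance
  exact h.1.eqSign (A.weight_pos i) f hf hk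

variable (A i) in
theorem isForm_smul_primitiveForm : A.IsForm i (A.weight i • A.primitiveForm i) := by
  obtain ⟨f, hf⟩ := exists_functional_quotCoord (A.basis i)
  refine ⟨⟨_, .of_functional f hf, rfl⟩, fun n hn => ?_⟩
  have := contract_ιMulti_quotCoord (A.basis i) hn
  change contract n (A.weight i • (A.primitiveForm i : DualExt N)) = 0
  rw [map_nsmul]
  exact (congrArg _ this).trans (smul_zero _)

end AffineConstraint

end Forms

section TopForms

variable {N : Type*} [AddCommGroup N] {r : ℕ}

theorem pairingDual_dualBasis (b : Basis (Fin r) ℤ N) :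
    exteriorPower.pairingDual ℤ N r (exteriorPower.ιMulti ℤ r b.dualBasis)
      (exteriorPower.ιMulti ℤ r b) = 1 := by
  rw [exteriorPower.pairingDual_ιMulti_ιMulti]
  convert Matrix.det_one (n := Fin r) (R := ℤ)
  ext i j
  rw [Matrix.of_apply, Matrix.one_apply]
  simp [Finsupp.single_apply]

theorem hasIndex_of_eq_smul (b : Basis (Fin r) ℤ N) {ω : ⋀[ℤ]^r (DualLattice N)} {c : ℤ}
    (hω : ω = c • exteriorPower.ιMulti ℤ r b.dualBasis) : HasIndex ω c.natAbs := by
  rw [hω]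
  exact .smul_of_functional ((exteriorPower.pairingDual ℤ N r).flip (exteriorPower.ιMulti ℤ r b))
    (pairingDual_dualBasis b) c

theorem abs_pairingDual_of_eq_smul (b : Basis (Fin r) ℤ N) {ω : ⋀[ℤ]^r (DualLattice N)} {c : ℤ}
    (hω : ω = c • exteriorPower.ιMulti ℤ r b.dualBasis) {Ω : ⋀[ℤ]^r N} (hΩ : IsPrimitive Ω) :
    |exteriorPower.pairingDual ℤ N r ω Ω| = (c.natAbs : ℤ) := by
  obtain ⟨j, rfl⟩ := exteriorPower.exists_eq_smul_ιMulti b Ω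
  rw [hω, map_smul, map_smul, LinearMap.smul_apply, pairingDual_dualBasis, smul_eq_mul, smul_eq_mul,
    mul_one, abs_mul, Int.abs_eq_natAbs j, hΩ.natAbs_eq_one, Int.abs_eq_natAbs]
  simp

end TopForms

end TropicalCurves

end

/-! ### Rooted forests. -/

section

open ExteriorAlgebra Module

namespace TropicalCurves

/-- A finite forest of edges oriented towards its roots: every vertex has at most one outgoing edge
and there are no oriented cycles. -/
structure IsForest {E V : Type*} (tail head : E → V) : Prop where
  tail_injective : Function.Injective tail
  acyclic : ∀ v, ¬ Relation.TransGen (fun a b => ∃ e, tail e = a ∧ head e = b) v v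

namespace IsForest

variable {E V : Type*} {tail head : E → V}

/-- `e` is an edge of the path from `v` to the root. -/
def Below (tail head : E → V) (v : V) (e : E) : Prop :=
  Relation.ReflTransGen (fun a b => ∃ e, tail e = a ∧ head e = b) v (tail e)

theorem below_tail_self (e : E) : Below tail head (tail e) e := Relation.ReflTransGen.refl

theorem not_below_head_self (h : IsForest tail head) (e : E) : ¬ Below tail head (head e) e :=
  fun hb => h.acyclic (tail e) (Relation.TransGen.head' ⟨e, rfl, rfl⟩ hb)

theorem below_tail_iff (h : IsForest tail head) {e e' : E} (hne : e' ≠ e) :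
    Below tail head (tail e) e' ↔ Below tail head (head e) e' := by
  constructor
  · intro hb
    rcases Relation.ReflTransGen.cases_head hb with hb | ⟨v, ⟨e₁, h₁, rfl⟩, hb⟩
    · exact absurd (h.tail_injective hb).symm hne
    · rwa [h.tail_injective h₁] at hb
  · exact fun hb => Relation.ReflTransGen.head ⟨e, rfl, rfl⟩ hb

theorem wellFounded [Finite V] (h : IsForest tail head) :
    WellFounded (Relation.TransGen (fun a b => ∃ e, tail e = a ∧ head e = b)) :=
  haveI : Std.Irrefl (Relation.TransGen (fun a b => ∃ e, tail e = a ∧ head e = b)) := ⟨h.acyclic⟩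
  Finite.wellFounded_of_trans_of_irrefl _

/-- Induction along the paths to the root. -/
theorem root_induction [Finite V] (h : IsForest tail head) {v₀ : V}
    (hv₀ : ∀ v, (∀ e, tail e ≠ v) ↔ v = v₀) {P : V → Prop} (root : P v₀)
    (step : ∀ e, P (head e) → P (tail e)) (v : V) : P v := by
  let r : V → V → Prop := fun a b =>
    Relation.TransGen (fun a b => ∃ e, tail e = a ∧ head e = b) b a
  have : IsTrans V r := ⟨fun _ _ _ hab hbc => hbc.trans hab⟩
  have : Std.Irrefl r := ⟨h.acyclic⟩
  induction v using (Finite.wellFounded_of_trans_of_irrefl r).induction with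
  | _ v ih =>
    by_cases hv : v = v₀
    · exact hv ▸ root
    · have := mt (hv₀ v).mp hv
      push Not at this
      obtain ⟨e, rfl⟩ := this
      exact step e (ih _ (Relation.TransGen.single ⟨e, rfl, rfl⟩))

/-- Applied to the set of edges not yet contracted, this yields the next edge to contract. -/
theorem exists_source [Finite V] (h : IsForest tail head) {s : Set E} (hs : s.Nonempty) :
    ∃ e ∈ s, ∀ e', head e' = tail e → e' ∉ s := by
  obtain ⟨v, ⟨e, he, rfl⟩, hmin⟩ := h.wellFounded.has_min (tail '' s) (hs.image _)
  exact ⟨e, he, fun e' he' hs' =>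
    hmin (tail e') ⟨e', hs', rfl⟩ (Relation.TransGen.single ⟨e', rfl, he'⟩)⟩

/-- An edge below `v` all of whose predecessors lie in a set closed under predecessors starts at
`v`, unless an edge of the set does. -/
theorem eq_tail_of_below {s : Set E} (hs : ∀ e ∈ s, ∀ e', head e' = tail e → e' ∈ s) {e : E}
    (he : ∀ e', head e' = tail e → e' ∈ s) {v : V} (hb : Below tail head v e)
    (hv : ∀ e' ∈ s, tail e' ≠ v) : v = tail e := by
  have key : v = tail e ∨ ∃ e' ∈ s, tail e' = v := by
    unfold Below at hb
    clear hv
    induction hb using Relation.ReflTransGen.head_induction_on with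
    | refl => exact Or.inl rfl
    | head h' _ ih =>
      obtain ⟨e₁, rfl, h₁⟩ := h'
      rcases ih with ih | ⟨e', he', ih⟩
      · exact Or.inr ⟨e₁, he e₁ (h₁.trans ih), rfl⟩
      · exact Or.inr ⟨e₁, hs e' he' e₁ (h₁.trans ih.symm), rfl⟩
  rcases key with h | ⟨e', he', h⟩
  · exact h
  · exact absurd h (hv e' he')

end IsForest

open IsForest

/-! ### Vertex positions as sums along paths to the root. -/

section Path

variable {N E V : Type*} [AddCommGroup N] [Fintype E] (tail head : E → V)

open Classical in
/-- The sum of a family of vectors along the path from `v` to the root. -/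
noncomputable def pathSum (v : V) (g : E → N) : N :=
  ∑ e, if Below tail head v e then g e else 0

variable {tail head}

theorem pathSum_tail (h : IsForest tail head) (e : E) (g : E → N) :
    pathSum tail head (tail e) g = g e + pathSum tail head (head e) g := by
  classical
  simp only [pathSum]
  rw [← Finset.add_sum_erase _ _ (Finset.mem_univ e),
    ← Finset.add_sum_erase (a := e) (f := fun e' => if Below tail head (head e) e' then _ else _) _
      (Finset.mem_univ e), if_pos (below_tail_self e), if_neg (h.not_below_head_self e), zero_add]
  congr 1
  refine Finset.sum_congr rfl fun e' he' => ?_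
  rw [h.below_tail_iff (Finset.ne_of_mem_erase he')]

theorem pathSum_root {v : V} (hv : ∀ e, tail e ≠ v) (g : E → N) : pathSum tail head v g = 0 := by
  classical
  rw [pathSum]
  refine Finset.sum_eq_zero fun e _ => if_neg fun hb => ?_
  rcases Relation.ReflTransGen.cases_head hb with hb | ⟨w, ⟨e₁, h₁, rfl⟩, -⟩
  · exact hv e hb.symm
  · exact hv e₁ h₁

open Classical in
theorem pathSum_single [DecidableEq E] (v : V) (e : E) (n : N) :
    pathSum tail head v (Pi.single e n) = if Below tail head v e then n else 0 := by
  rw [pathSum, Finset.sum_eq_single e]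
  · rw [Pi.single_eq_same]
  · intro e' _ he'
    rw [Pi.single_eq_of_ne he', ite_self]
  · exact fun h => absurd (Finset.mem_univ e) h

variable (tail head) in
open Classical in
/-- The position of the vertex `v`, as a function of the position of the root and of the lengths
of the edges in terms of the vectors `u e`. -/
noncomputable def posMap (u : E → N) (v : V) : N × (E → ℤ) →ₗ[ℤ] N :=
  LinearMap.fst ℤ N (E → ℤ) + ∑ e, if Below tail head v e then
    (LinearMap.proj e ∘ₗ LinearMap.snd ℤ N (E → ℤ)).smulRight (u e) else 0

theorem posMap_apply (u : E → N) (v : V) (m : N) (t : E → ℤ) :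
    posMap tail head u v (m, t) = m + pathSum tail head v fun e => t e • u e := by
  rw [posMap, LinearMap.add_apply, LinearMap.sum_apply, pathSum]
  congr 1
  exact Finset.sum_congr rfl fun e _ => by split_ifs <;> rfl

theorem posMap_tail (h : IsForest tail head) (u : E → N) (e : E) :
    posMap tail head u (tail e) = posMap tail head u (head e) +
      (LinearMap.proj e ∘ₗ LinearMap.snd ℤ N (E → ℤ)).smulRight (u e) := by
  refine LinearMap.ext fun ⟨m, t⟩ => ?_
  rw [LinearMap.add_apply, posMap_apply, posMap_apply, pathSum_tail h]
  simp only [LinearMap.smulRight_apply, LinearMap.comp_apply, LinearMap.snd_apply,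
    LinearMap.proj_apply]
  abel

/-- Evaluation at the unit vector of the edge `e`. -/
noncomputable def edgeEval [DecidableEq E] (e : E) : Dual ℤ (Dual ℤ (N × (E → ℤ))) :=
  Dual.eval ℤ _ (0, Pi.single e 1)

theorem edgeEval_comp [DecidableEq E] (u : E → N) (v : V) (e : E) :
    (edgeEval e : Dual ℤ (Dual ℤ (N × (E → ℤ)))) ∘ₗ (posMap tail head u v).dualMap =
      Dual.eval ℤ N (pathSum tail head v (Pi.single e (u e))) := by
  have : posMap tail head u v (0, Pi.single e 1) = pathSum tail head v (Pi.single e (u e)) := by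
    rw [posMap_apply, zero_add]
    congr 1
    funext e'
    by_cases h : e' = e
    · subst h; rw [Pi.single_eq_same, Pi.single_eq_same, one_smul]
    · rw [Pi.single_eq_of_ne h, Pi.single_eq_of_ne h, zero_smul]
  ext m
  rw [← this]
  rfl

end Path

/-! ### Contraction edge by edge along the flow. -/

section Contraction

variable {N I E V : Type*} [AddCommGroup N] [Fintype E]
  {tail head : E → V} {leg : I → V}

/-- Elements attached to the edges and legs of a forest, such that up to sign the element of an
edge is the contraction by `u e` of the product of the elements of its predecessors. -/
structure IsFlowFamily (tail head : E → V) (leg : I → V) (u : E → N) (A : E ⊕ I → DualExt N) :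
    Prop where
  isHomog : ∀ x, IsHomog (A x)
  contract : ∀ e (l : List (E ⊕ I)), l.Nodup → (∀ x, x ∈ l ↔ Sum.elim head leg x = tail e) →
    EqSign (contract (u e) (l.map A).prod) (A (Sum.inl e))

/-- The pullback of `a` along the position of the vertex `v`. -/
noncomputable abbrev pull (tail head : E → V) (u : E → N) (v : V) :
    DualExt N →ₐ[ℤ] ExteriorAlgebra ℤ (Dual ℤ (N × (E → ℤ))) :=
  ExteriorAlgebra.map (posMap tail head u v).dualMap

/-- The positions of the two ends differ by the rank-one term `t e • u e`, invisible to a form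
killed by `u e`. -/
theorem pull_tail (h : IsForest tail head) (u : E → N) (e : E) {a : DualExt N}
    (ha : TropicalCurves.contract (u e) a = 0) :
    pull tail head u (tail e) a = pull tail head u (head e) a := by
  have : (posMap tail head u (tail e)).dualMap = (posMap tail head u (head e)).dualMap +
      (Dual.eval ℤ N (u e)).smulRight (LinearMap.proj e ∘ₗ LinearMap.snd ℤ N (E → ℤ)) := by
    rw [posMap_tail h]
    ext m : 1
    refine LinearMap.ext fun x => ?_
    simp [mul_comm]
  rw [pull, this]
  exact map_add_smulRight_of_contr _ _ ha

theorem contr_edgeEval_pull [DecidableEq E] (u : E → N) (v : V) (e : E) (a : DualExt N) :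
    contr (edgeEval e) (pull tail head u v a) = pull tail head u v
      (TropicalCurves.contract (pathSum tail head v (Pi.single e (u e))) a) := by
  rw [pull, contr_map, edgeEval_comp]
  rfl

theorem list_prod_pull {L : List (E ⊕ I)} (u : E → N) (w : E ⊕ I → V) {v : V}
    (h : ∀ x ∈ L, w x = v) (A : E ⊕ I → DualExt N) :
    (L.map fun x => pull tail head u (w x) (A x)).prod = pull tail head u v (L.map A).prod := by
  rw [map_list_prod, List.map_map]
  congr 1
  exact List.map_congr_left fun x hx => by rw [h x hx]; rfl

theorem contrList_append_singleton {R X : Type*} [CommRing R] [AddCommGroup X] [Module R X]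
    (l : List (Dual R X)) (d : Dual R X) (a : ExteriorAlgebra R X) :
    contrList (l ++ [d]) a = contr d (contrList l a) := by
  induction l generalizing a with
  | nil => rfl
  | cons d' l ih => exact ih _

/-- Induction on the number `k` of contracted edges. The list `l` holds these edges and is closed
under predecessors; `L` holds the current factors, namely the legs and contracted edges whose target
is not the tail of a contracted edge, so that they have not yet been absorbed. -/
theorem exists_contrList_aux [DecidableEq E] [Finite V] (hF : IsForest tail head) {u : E → N}
    {A : E ⊕ I → DualExt N} (hA : IsFlowFamily tail head leg u A) {l₀ : List I} (h₀ : l₀.Nodup)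
    (h₀' : ∀ i, i ∈ l₀) (k : ℕ) (hk : k ≤ Fintype.card E) :
    ∃ l : List E, l.length = k ∧ l.Nodup ∧ (∀ e ∈ l, ∀ e', head e' = tail e → e' ∈ l) ∧
      ∃ L : List (E ⊕ I), L.Nodup ∧
        (∀ x, x ∈ L ↔ (∀ e, x = Sum.inl e → e ∈ l) ∧ ∀ e ∈ l, tail e ≠ Sum.elim head leg x) ∧
        EqSign (contrList (l.map edgeEval)
            (l₀.map fun i => pull tail head u (leg i) (A (Sum.inr i))).prod)
          (L.map fun x => pull tail head u (Sum.elim head leg x) (A x)).prod := by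
  classical
  induction k with
  | zero =>
    refine ⟨[], rfl, List.nodup_nil, by simp, l₀.map Sum.inr, h₀.map Sum.inr_injective, ?_, ?_⟩
    · rintro (e | i)
      · simp
      · simp [h₀' i]
    · rw [List.map_map]
      exact EqSign.refl _
  | succ k ih =>
    obtain ⟨l, hlen, hnd, hcl, L, hLnd, hL, hprod⟩ := ih (by omega)
    obtain ⟨e, he, hpred⟩ := hF.exists_source (s := {e | e ∉ l}) (by
      by_contra hcon
      rw [Set.not_nonempty_iff_eq_empty, Set.eq_empty_iff_forall_notMem] at hcon
      have : Fintype.card E ≤ l.length := by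
        rw [← List.toFinset_card_of_nodup hnd, ← Finset.card_univ]
        exact Finset.card_le_card fun e _ => List.mem_toFinset.mpr (not_not.mp (hcon e))
      omega)
    simp only [Set.mem_ofPred_eq, not_not] at he hpred
    set w : E ⊕ I → V := Sum.elim head leg with hw
    -- `L₁` collects the factors at the tail of `e`, to be merged into the single factor of `e`;
    -- `L₂` collects the others.
    let L₁ := L.filter fun x => w x = tail e
    let L₂ := L.filter fun x => ¬ w x = tail e
    have hL₁ : ∀ x, x ∈ L₁ ↔ w x = tail e := by
      intro x
      rw [List.mem_filter, hL, decide_eq_true_iff]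
      refine ⟨fun h => h.2, fun h => ⟨⟨?_, ?_⟩, h⟩⟩
      · rintro e' rfl
        exact hpred e' h
      · intro e' he' h'
        rw [h] at h'
        exact he (hF.tail_injective h' ▸ he')
    have hL₂ : ∀ x, x ∈ L₂ ↔ x ∈ L ∧ w x ≠ tail e := by
      intro x
      rw [List.mem_filter, decide_eq_true_iff]
    refine ⟨l ++ [e], by simp [hlen], ?_, ?_, Sum.inl e :: L₂, ?_, ?_, ?_⟩
    · rw [List.nodup_append]
      refine ⟨hnd, by simp, ?_⟩
      rintro a ha b hb rfl
      exact he (List.mem_singleton.mp hb ▸ ha)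
    · intro e₁ h₁ e' he'
      rw [List.mem_append, List.mem_singleton] at h₁ ⊢
      rcases h₁ with h₁ | rfl
      · exact Or.inl (hcl e₁ h₁ e' he')
      · exact Or.inl (hpred e' he')
    · rw [List.nodup_cons]
      refine ⟨fun h => he (((hL _).mp ((hL₂ _).mp h).1).1 e rfl), hLnd.filter _⟩
    · intro x
      rw [List.mem_cons, hL₂, hL]
      simp only [List.mem_append, List.mem_singleton]
      constructor
      · rintro (rfl | ⟨⟨h1, h2⟩, h3⟩)
        · refine ⟨fun e' h' => Or.inr (Sum.inl_injective h').symm, ?_⟩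
          rintro e' (h' | rfl) h''
          · exact he (hcl e' h' e h''.symm)
          · exact hF.acyclic _ (Relation.TransGen.single ⟨e', rfl, h''.symm⟩)
        · refine ⟨fun e' h' => Or.inl (h1 e' h'), ?_⟩
          rintro e' (h' | rfl)
          · exact h2 e' h'
          · exact h3.symm
      · rintro ⟨h1, h2⟩
        by_cases hx : x = Sum.inl e
        · exact Or.inl hx
        · refine Or.inr ⟨⟨fun e' h' => ?_, fun e' h' => h2 e' (Or.inl h')⟩,
            (h2 e (Or.inr rfl)).symm⟩
          refine (h1 e' h').resolve_right fun h => hx (h ▸ h')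
    · rw [List.map_append, List.map_singleton, contrList_append_singleton]
      refine (hprod.map (contr (edgeEval e))).trans ?_
      have hperm : L.Perm (L₁ ++ L₂) := by
        have := (List.filter_append_perm (fun x => decide (w x = tail e)) L).symm
        simpa [L₁, L₂] using this
      refine ((map_prod_perm (f := fun x => pull tail head u (w x) (A x)) hperm
        fun x _ => (hA.isHomog x).map _).map (contr (edgeEval e))).trans ?_
      -- A factor of `L₂` whose path to the root contains `e` would sit at the tail of `e` or at
      -- that of a contracted edge; both are excluded, so these factors do not depend on the length
      -- of `e`.
      have hzero : contr (edgeEval e) (L₂.map fun x => pull tail head u (w x) (A x)).prod = 0 := by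
        apply contr_list_prod_eq_zero
        simp only [List.mem_map, forall_exists_index, and_imp]
        rintro _ x hx rfl
        obtain ⟨hx, hx'⟩ := (hL₂ x).mp hx
        rw [contr_edgeEval_pull, pathSum_single, if_neg]
        · simp [contract_eq]
        · intro hb
          exact hx' (eq_tail_of_below (s := {e | e ∈ l}) hcl hpred hb ((hL x).mp hx).2)
      rw [List.map_append, List.prod_append, contr_mul_of_right hzero, List.map_cons,
        List.prod_cons]
      refine EqSign.mul ?_ (EqSign.refl _)
      -- Contraction squares to zero, so the merged form may be pulled back from the head of `e`
      -- instead of its tail.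
      have hz : TropicalCurves.contract (u e)
          (TropicalCurves.contract (u e) (L₁.map A).prod) = 0 := contr_contr _ _
      rw [list_prod_pull u w (fun x hx => (hL₁ x).mp hx) A, contr_edgeEval_pull, pathSum_single,
        if_pos (below_tail_self e), pull_tail hF u e hz]
      exact (hA.contract e L₁ (hLnd.filter _) hL₁).map (pull tail head u (head e))

theorem map_inl_pull (u : E → N) {v : V} (hv : ∀ e, tail e ≠ v) (a : DualExt N) :
    ExteriorAlgebra.map (LinearMap.inl ℤ N (E → ℤ)).dualMap (pull tail head u v a) = a := by
  have h : posMap tail head u v ∘ₗ LinearMap.inl ℤ N (E → ℤ) = LinearMap.id := by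
    refine LinearMap.ext fun m => ?_
    rw [LinearMap.comp_apply, LinearMap.inl_apply, posMap_apply, pathSum_root hv, add_zero]
    rfl
  rw [pull, ← AlgHom.comp_apply, map_comp_map, LinearMap.dualMap_comp_dualMap, h,
    LinearMap.dualMap_id, map_id]
  rfl

/-- Contracting the product of the pulled back elements of the legs along all edges gives, up to
sign, the product of the elements of the edges at the root. -/
theorem exists_contrList_eqSign [DecidableEq E] [Finite V] (hF : IsForest tail head) {u : E → N}
    {A : E ⊕ I → DualExt N} (hA : IsFlowFamily tail head leg u A) {v₀ : V}
    (hv₀ : ∀ v, (∀ e, tail e ≠ v) ↔ v = v₀) {l₀ : List I} (h₀ : l₀.Nodup) (h₀' : ∀ i, i ∈ l₀)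
    {L : List (E ⊕ I)} (hL : L.Nodup) (hL' : ∀ x, x ∈ L ↔ Sum.elim head leg x = v₀) :
    ∃ l : List E, l.Nodup ∧ (∀ e, e ∈ l) ∧
      EqSign (ExteriorAlgebra.map (LinearMap.inl ℤ N (E → ℤ)).dualMap
        (contrList (l.map edgeEval)
          (l₀.map fun i => pull tail head u (leg i) (A (Sum.inr i))).prod)) (L.map A).prod := by
  obtain ⟨l, hlen, hnd, -, L', hL'nd, hL'mem, hprod⟩ :=
    exists_contrList_aux hF hA h₀ h₀' (Fintype.card E) le_rfl
  have hall : ∀ e, e ∈ l := by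
    intro e
    rw [← List.mem_toFinset, Finset.eq_univ_of_card l.toFinset
      (by rw [List.toFinset_card_of_nodup hnd, hlen])]
    exact Finset.mem_univ e
  refine ⟨l, hnd, hall, ?_⟩
  have hperm : L'.Perm L := by
    rw [List.perm_ext_iff_of_nodup hL'nd hL]
    intro x
    rw [hL'mem, hL', ← hv₀]
    exact ⟨fun h e => h.2 e (hall e), fun h => ⟨fun e _ => hall e, fun e _ => h e⟩⟩
  refine (hprod.map (ExteriorAlgebra.map (LinearMap.inl ℤ N (E → ℤ)).dualMap)).trans ?_
  have hmem : ∀ x ∈ L', Sum.elim head leg x = v₀ := fun x hx => (hL' x).mp (hperm.mem_iff.mp hx)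
  rw [list_prod_pull u _ hmem A, map_inl_pull u ((hv₀ v₀).mpr rfl)]
  exact map_prod_perm hperm fun x _ => hA.isHomog x

end Contraction

end TropicalCurves

end

/-! ### The determinant of the leg map. -/

section

open ExteriorAlgebra Module

namespace TropicalCurves

section Determinant

variable {N I E V : Type*} [AddCommGroup N] [Module.Free ℤ N] [Module.Finite ℤ N]
  [Fintype I] [Fintype E] {tail head : E → V} {leg : I → V}

variable (tail head leg) in
/-- The positions of the legs modulo the constraints, as a function of the position of the root and
of the lengths of the edges. -/
noncomputable def legMap (A : AffineConstraint N I) (u : E → N) :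
    N × (E → ℤ) →ₗ[ℤ] ((i : I) → N ⧸ latticePoints (A.space i).direction) :=
  LinearMap.pi fun i => (latticePoints (A.space i).direction).mkQ ∘ₗ posMap tail head u (leg i)

/-- The basis of `N × ℤ^E` given by a basis of `N`. -/
noncomputable def prodBasis {r : ℕ} (b : Basis (Fin r) ℤ N) :
    Basis (Fin r ⊕ E) ℤ (N × (E → ℤ)) :=
  b.prod (Pi.basisFun ℤ E)

/-- The basis of the product of the lattices of translates of the constraints. -/
noncomputable def AffineConstraint.prodBasis (A : AffineConstraint N I) :
    Basis (Σ i, Fin (A.codim i)) ℤ ((i : I) → N ⧸ latticePoints (A.space i).direction) :=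
  Pi.basis A.basis

/-- The functional on `N × ℤ^E` which is a coordinate of `legMap`. -/
noncomputable def legFunctional (tail head : E → V) (leg : I → V) (A : AffineConstraint N I)
    (u : E → N) (j : Σ i, Fin (A.codim i)) : Dual ℤ (N × (E → ℤ)) :=
  (posMap tail head u (leg j.1)).dualMap (A.functional j.1 j.2)

theorem legMap_repr (A : AffineConstraint N I) (u : E → N) (x : N × (E → ℤ))
    (j : Σ i, Fin (A.codim i)) :
    A.prodBasis.repr (legMap tail head leg A u x) j = legFunctional tail head leg A u j x := by
  rw [AffineConstraint.prodBasis, Pi.basis_repr]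
  rfl

variable {r : ℕ} (b : Basis (Fin r) ℤ N) (A : AffineConstraint N I) (u : E → N)
  (ρ : (Σ i, Fin (A.codim i)) ≃ Fin r ⊕ E)

/-- The determinant of `legMap` in the given bases. -/
noncomputable def legDet [DecidableEq I] (tail head : E → V) (leg : I → V) : ℤ :=
  A.prodBasis.det (legMap tail head leg A u ∘ (prodBasis b).reindex ρ.symm)

variable [DecidableEq I]

theorem index_range_legMap :
    (LinearMap.range (legMap tail head leg A u)).toAddSubgroup.index =
      (legDet b A u ρ tail head leg).natAbs :=
  index_range_eq_natAbs_det _ _ _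

/-- The column of the edge `e` is multiplied by `w e`, while the columns coming from `N` do not
involve the directions. -/
theorem legDet_smul (w : E → ℕ) :
    legDet b A (fun e => w e • u e) ρ tail head leg =
      ((∏ e, w e : ℕ) : ℤ) * legDet b A u ρ tail head leg := by
  classical
  have h : legMap tail head leg A (fun e => w e • u e) ∘ (prodBasis b).reindex ρ.symm =
      fun j => Sum.elim (fun _ => 1) (fun e => (w e : ℤ)) (ρ j) •
        (legMap tail head leg A u ∘ (prodBasis b).reindex ρ.symm) j := by
    funext j
    rw [Function.comp_apply, Function.comp_apply, Basis.reindex_apply, Equiv.symm_symm, ← map_smul]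
    funext i
    simp only [legMap, LinearMap.pi_apply, LinearMap.comp_apply]
    congr 1
    rcases ρ j with k | e
    · simp only [prodBasis, Basis.prod_apply, Sum.elim_inl, one_smul, Function.comp_apply,
        LinearMap.inl_apply, posMap_apply]
      simp
    · simp only [prodBasis, Basis.prod_apply, Sum.elim_inr, Function.comp_apply,
        LinearMap.inr_apply, posMap_apply, Prod.smul_mk, Pi.basisFun_apply]
      congr 2
      · simp
      · funext e'
        by_cases he : e' = e
        · subst he; simp
        · simp [Pi.single_eq_of_ne he]
  rw [legDet, h, AlternatingMap.map_smul_univ, ← legDet, smul_eq_mul]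
  congr 1
  rw [← Equiv.prod_comp ρ.symm]
  simp

theorem dualBasis_det_legFunctional [DecidableEq E] :
    ((prodBasis (E := E) b).dualBasis.reindex ρ.symm).det (legFunctional tail head leg A u) =
      legDet b A u ρ tail head leg := by
  rw [legDet, Basis.det_apply, Basis.det_apply, ← Matrix.det_transpose]
  congr 1
  ext j j'
  rw [Matrix.transpose_apply, Basis.toMatrix_apply, Basis.toMatrix_apply, Function.comp_apply,
    legMap_repr, Basis.repr_reindex_apply, Basis.dualBasis_repr, Basis.reindex_apply]

/-- The product of the forms of the legs, contracted along all edges, in terms of `legDet`. -/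
theorem contrList_prod_primitiveForm [DecidableEq E] {l₀ : List I} (h₀ : l₀.Nodup)
    (h₀' : ∀ i, i ∈ l₀) {l : List E} (hl : l.Nodup) (hl' : ∀ e, e ∈ l) :
    EqSign (legDet b A u ρ tail head leg • (ExteriorAlgebra.ιMulti ℤ r b.dualBasis : DualExt N))
      (ExteriorAlgebra.map (LinearMap.inl ℤ N (E → ℤ)).dualMap
        (contrList (l.map edgeEval)
          (l₀.map fun i => pull tail head u (leg i) (A.primitiveForm i : DualExt N)).prod)) := by
  let lJ : List (Σ i, Fin (A.codim i)) := l₀.sigma fun i => List.finRange (A.codim i)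
  have hlJ : lJ.Nodup := h₀.sigma fun i => List.nodup_finRange _
  have hlJ' : ∀ j, j ∈ lJ := fun j => List.mem_sigma.mpr ⟨h₀' _, List.mem_finRange _⟩
  let β : Basis (Fin r ⊕ E) ℤ (Dual ℤ (N × (E → ℤ))) := (prodBasis b).dualBasis
  have h1 : (l₀.map fun i => pull tail head u (leg i) (A.primitiveForm i : DualExt N)).prod =
      (lJ.map fun j => ι ℤ (legFunctional tail head leg A u j)).prod := by
    have hsig : ∀ l₁ : List I,
        (l₁.map fun i => pull tail head u (leg i) (A.primitiveForm i : DualExt N)).prod =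
        ((l₁.sigma fun i => List.finRange (A.codim i)).map
          fun j => ι ℤ (legFunctional tail head leg A u j)).prod := by
      intro l₁
      induction l₁ with
      | nil => rfl
      | cons i l₁ ih =>
        rw [List.map_cons, List.prod_cons, ih, List.sigma_cons, List.map_append, List.prod_append]
        congr 1
        rw [AffineConstraint.primitiveForm, exteriorPower.ιMulti_apply_coe, pull, map_apply_ιMulti,
          ιMulti_apply, List.ofFn_eq_map, List.map_map]
        rfl
    exact hsig l₀
  have h2 := list_prod_ι_eq_det_smul (β.reindex ρ.symm) (legFunctional tail head leg A u) hlJ hlJ'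
  rw [dualBasis_det_legFunctional] at h2
  -- Reorder the volume form so that the edge covectors come first, in the order of contraction.
  have hperm : (lJ.map ρ).Perm (l.map Sum.inr ++ (List.finRange r).map Sum.inl) := by
    rw [List.perm_ext_iff_of_nodup (hlJ.map ρ.injective)]
    · rintro (k | e)
      · simpa using ⟨_, _, hlJ' (ρ.symm (Sum.inl k)), by simp⟩
      · simpa [hl' e] using ⟨_, _, hlJ' (ρ.symm (Sum.inr e)), by simp⟩
    · rw [List.nodup_append]
      refine ⟨hl.map Sum.inr_injective, (List.nodup_finRange r).map Sum.inl_injective, ?_⟩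
      simp
  have h3 : (lJ.map fun j => ι ℤ ((β.reindex ρ.symm) j)).prod =
      ((lJ.map ρ).map fun x => ι ℤ (β x)).prod := by
    rw [List.map_map]
    simp [Function.comp_def]
  have h4 := map_prod_perm (f := fun x => ι ℤ (β x)) hperm.symm fun x _ => ⟨1, ι_mem _⟩
  rw [List.map_append, List.prod_append, List.map_map, List.map_map] at h4
  have hinr : ∀ e, β (Sum.inr e) = LinearMap.proj e ∘ₗ LinearMap.snd ℤ N (E → ℤ) := by
    intro e
    rw [Basis.coe_dualBasis]
    refine LinearMap.ext fun x => ?_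
    simp [prodBasis]
  have hinl : ∀ k, β (Sum.inl k) = b.coord k ∘ₗ LinearMap.fst ℤ N (E → ℤ) := by
    intro k
    rw [Basis.coe_dualBasis]
    refine LinearMap.ext fun x => ?_
    simp [prodBasis]
  -- Each contraction removes its own edge covector; the covectors of `N` vanish on all edge
  -- vectors.
  have h5 : contrList (l.map edgeEval) ((l.map ((fun x => ι ℤ (β x)) ∘ Sum.inr)).prod *
      ((List.finRange r).map ((fun x => ι ℤ (β x)) ∘ Sum.inl)).prod) =
      ((List.finRange r).map ((fun x => ι ℤ (β x)) ∘ Sum.inl)).prod := by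
    have := contrList_ι_prod_mul
      (l.map fun e => ((edgeEval e : Dual ℤ (Dual ℤ (N × (E → ℤ)))), β (Sum.inr e)))
      ((List.finRange r).map ((fun x => ι ℤ (β x)) ∘ Sum.inl)).prod ?_ ?_ ?_
    · simpa only [List.map_map, Function.comp_def] using this
    · simp only [List.mem_map, forall_exists_index, and_imp]
      rintro _ e _ rfl
      simp [edgeEval, hinr]
    · rw [List.pairwise_map]
      refine hl.imp fun {e e'} hne => ?_
      simp [edgeEval, hinr, Pi.single_eq_of_ne hne.symm]
    · simp only [List.mem_map, forall_exists_index, and_imp]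
      rintro _ e _ rfl
      apply contr_list_prod_eq_zero
      simp only [List.mem_map, forall_exists_index, and_imp]
      rintro _ k _ rfl
      refine (CliffordAlgebra.contractLeft_ι (Q := (0 : QuadraticForm ℤ _)) _ _).trans ?_
      simp [edgeEval, hinl]
  have h6 : ExteriorAlgebra.map (LinearMap.inl ℤ N (E → ℤ)).dualMap
      ((List.finRange r).map ((fun x => ι ℤ (β x)) ∘ Sum.inl)).prod =
      ExteriorAlgebra.ιMulti ℤ r b.dualBasis := by
    rw [map_list_prod, List.map_map, ιMulti_apply, List.ofFn_eq_map]
    congr 1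
    refine List.map_congr_left fun k _ => ?_
    simp only [Function.comp_apply, map_apply_ι, hinl]
    congr 1
    ext x
    simp
  rw [h1, h2, h3, map_smul, map_smul]
  have h7 := (h4.map (contrList (l.map edgeEval))).map
    (ExteriorAlgebra.map (LinearMap.inl ℤ N (E → ℤ)).dualMap)
  rw [h5, h6] at h7
  exact h7.map (LinearMap.lsmul ℤ (DualExt N) (legDet b A u ρ tail head leg))

end Determinant

end TropicalCurves

end

/-! ### Flows on trees and the recursion for the `ζ_E`. -/

section

open ExteriorAlgebra Module

namespace TropicalCurves

variable {N I V E : Type*} [AddCommGroup N]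
  [Fintype I] [DecidableEq V] [Fintype E]

namespace Flow

variable {T : TropicalType N I V E} {vinf : V} (F : Flow T vinf)

/-- The direction vector of a compact edge, pointing opposite to the flow. -/
def unitDir (e : E) : N := if F.forward e then -T.edgeDir e else T.edgeDir e

theorem direction_inl (e : E) : F.direction (Sum.inl e) = T.edgeWeight e • F.unitDir e := by
  simp only [direction, Sum.elim_inl, unitDir]
  split_ifs <;> rfl

theorem card_edges [Fintype V] (hgenus : T.genus = 0) (hv : ∀ v, T.vertexGenus v = 0) :
    Fintype.card E + 1 = Fintype.card V := by
  have h : ((Fintype.card E : ℤ) - (Fintype.card V : ℤ) + 1) + ∑ v, (T.vertexGenus v : ℤ) = 0 :=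
    hgenus
  simp only [hv, Nat.cast_zero, Finset.sum_const_zero] at h
  omega

-- Every vertex but the sink is the tail of some edge, and there are exactly as many edges as such
-- vertices, so no two edges share a tail.
include F in
theorem isForest [Fintype V] (hcard : Fintype.card E + 1 = Fintype.card V) : IsForest F.tail F.head where
  tail_injective := by
    have hmem : ∀ e, F.tail e ≠ vinf := (F.sink vinf).mpr rfl
    let t : E → {v : V // v ≠ vinf} := fun e => ⟨F.tail e, hmem e⟩
    have hsurj : Function.Surjective t := by
      rintro ⟨v, hv⟩
      have := mt (F.sink v).mp hv
      push Not at this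
      obtain ⟨e, he⟩ := this
      exact ⟨e, Subtype.ext he⟩
    have hc : Fintype.card E = Fintype.card {v : V // v ≠ vinf} := by
      rw [Fintype.card_subtype_compl, Fintype.card_subtype_eq]
      omega
    have hinj := ((Fintype.bijective_iff_surjective_and_card t).mpr ⟨hsurj, hc⟩).1
    exact fun e e' h => hinj (Subtype.ext h)
  acyclic := F.acyclic

/-- This is balancing sorted by the flow: `direction` is the weighted direction of an edge at its
head and the negative of that at its tail. -/
theorem sum_target (v : V) :
    (∑ x : E ⊕ I, if F.target x = v then F.direction x else 0) =
      ∑ e, if F.tail e = v then F.direction (Sum.inl e) else 0 := by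
  have hterm : ∀ e, (if F.head e = v then F.direction (Sum.inl e) else 0) -
      (if F.tail e = v then F.direction (Sum.inl e) else 0) =
      (if T.src e = v then T.edgeWeight e • T.edgeDir e else 0) +
        (if T.tgt e = v then T.edgeWeight e • -T.edgeDir e else 0) := by
    intro e
    rw [F.direction_inl, unitDir, F.tail_eq, F.head_eq]
    cases F.forward e
    · simp only [Bool.false_eq_true, if_false, smul_neg]
      split_ifs <;> abel
    · simp only [if_true, smul_neg]
      split_ifs <;> abel
  have hb := T.balanced v
  rw [← Finset.sum_add_distrib, ← Finset.sum_congr rfl fun e _ => hterm e,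
    Finset.sum_sub_distrib] at hb
  rw [Fintype.sum_sum_type, ← sub_eq_zero, add_sub_right_comm]
  exact hb

theorem sum_incoming_tail (hF : IsForest F.tail F.head) (e : E) {l : List (E ⊕ I)} (hl : l.Nodup)
    (hmem : ∀ x, x ∈ l ↔ F.target x = F.tail e) :
    (l.map F.direction).sum = F.direction (Sum.inl e) := by
  classical
  have h := F.sum_target (F.tail e)
  rw [Finset.sum_eq_single e (fun e' _ he' => if_neg fun h' => he' (hF.tail_injective h'))
    (fun h => absurd (Finset.mem_univ e) h), if_pos rfl] at h
  rw [← h, ← Finset.sum_filter, ← List.sum_toFinset _ hl]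
  exact Finset.sum_congr (by ext x; simp [hmem]) fun _ _ => rfl

theorem sum_incoming_sink {l : List (E ⊕ I)} (hl : l.Nodup)
    (hmem : ∀ x, x ∈ l ↔ F.target x = vinf) : (l.map F.direction).sum = 0 := by
  classical
  have h := F.sum_target vinf
  rw [Finset.sum_eq_zero fun e _ => if_neg ((F.sink vinf).mpr rfl e)] at h
  rw [← h, ← Finset.sum_filter, ← List.sum_toFinset _ hl]
  exact Finset.sum_congr (by ext x; simp [hmem]) fun _ _ => rfl

theorem nodup_ofFn_subtype {α : Type*} {p : α → Prop} {k : ℕ} (σ : Fin k ≃ {x // p x}) :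
    (List.ofFn fun j => (σ j : α)).Nodup ∧ ∀ x, x ∈ List.ofFn (fun j => (σ j : α)) ↔ p x := by
  refine ⟨List.nodup_ofFn.mpr (Subtype.val_injective.comp σ.injective), fun x => ?_⟩
  rw [List.mem_ofFn]
  constructor
  · rintro ⟨j, rfl⟩
    exact (σ j).2
  · exact fun hx => ⟨σ.symm ⟨x, hx⟩, by simp⟩

/-- The edges at the sink are those flowing into it. -/
theorem edgesAt_iff (F : Flow T vinf) (x : E ⊕ I) :
    Sum.elim (fun e => T.src e = vinf ∨ T.tgt e = vinf) (fun i => T.leg i = vinf) x ↔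
      F.target x = vinf := by
  rcases x with e | i
  · have h := (F.sink vinf).mpr rfl e
    rw [F.tail_eq] at h
    simp only [Sum.elim_inl, target, F.head_eq]
    cases hf : F.forward e <;> simp_all
  · rfl

/-- The inductive rule for the polyvectors of the elements `ζ_E`. -/
def IsFormFamily (A : AffineConstraint N I) (a : E ⊕ I → DualExt N) : Prop :=
  (∀ i, ∃ α : ⋀[ℤ]^(A.codim i) (DualLattice N), A.IsForm i α ∧ a (Sum.inr i) = (α : DualExt N)) ∧
    ∀ e, ∃ (k : ℕ) (σ : Fin k ≃ F.Incoming (F.tail e)),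
      a (Sum.inl e) = contract (F.direction (Sum.inl e)) (List.ofFn fun j => a (σ j)).prod

variable {F} {A : AffineConstraint N I}

theorem ell_eq_zmon (hF : IsForest F.tail F.head) {ζ : E ⊕ I → Polyvector N}
    {a : E ⊕ I → DualExt N} (e : E) {k : ℕ} (σ : Fin k ≃ F.Incoming (F.tail e))
    (h : ∀ j, ζ (σ j) = zmon (F.direction (σ j)) (a (σ j))) :
    ell k (fun j => ζ (σ j)) = zmon (F.direction (Sum.inl e))
      (contract (F.direction (Sum.inl e)) (List.ofFn fun j => a (σ j)).prod) := by
  simp only [h]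
  have hs := F.sum_incoming_tail hF e (nodup_ofFn_subtype σ).1 (nodup_ofFn_subtype σ).2
  rw [List.map_ofFn, List.sum_ofFn] at hs
  rw [ell_zmon]
  exact congrArg (fun n => zmon n (contract n (List.ofFn fun j => a (σ j)).prod)) hs

theorem IsFormFamily.isZeta (hF : IsForest F.tail F.head) {a : E ⊕ I → DualExt N}
    (ha : F.IsFormFamily A a) : F.IsZeta A fun x => zmon (F.direction x) (a x) := by
  refine ⟨fun i => ?_, fun e => ?_⟩
  · obtain ⟨α, hα, h⟩ := ha.1 i
    exact ⟨α, hα, (congrArg (zmon _) h).trans rfl⟩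
  · obtain ⟨k, σ, h⟩ := ha.2 e
    refine ⟨k, σ, ?_⟩
    rw [ell_eq_zmon hF (ζ := fun x => zmon (F.direction x) (a x)) e σ fun j => rfl, ← h]

variable [Fintype V]

/-- Induction along the flow. -/
@[elab_as_elim]
theorem edge_induction (hF : IsForest F.tail F.head) {P : E ⊕ I → Prop}
    (leg : ∀ i, P (Sum.inr i))
    (edge : ∀ e, (∀ x, F.target x = F.tail e → P x) → P (Sum.inl e)) (x : E ⊕ I) : P x := by
  rcases x with e | i
  · generalize hv : F.tail e = v
    induction v using hF.wellFounded.induction generalizing e with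
    | _ v ih =>
      refine edge e fun x hx => ?_
      rcases x with e' | i
      · exact ih (F.tail e') (Relation.TransGen.single ⟨e', rfl, hx.trans hv⟩) e' rfl
      · exact leg i
  · exact leg i

/-- The recursion along the flow defines a family. -/
theorem exists_family (hF : IsForest F.tail F.head) (f : I → DualExt N) (k : E → ℕ)
    (σ : ∀ e, Fin (k e) ≃ F.Incoming (F.tail e)) :
    ∃ a : E ⊕ I → DualExt N, (∀ i, a (Sum.inr i) = f i) ∧ ∀ e,
      a (Sum.inl e) = contract (F.direction (Sum.inl e)) (List.ofFn fun j => a (σ e j)).prod := by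
  have hwf := InvImage.wf F.tail hF.wellFounded
  -- Well-founded recursion on the tails of the compact edges, with the legs as initial data.
  let step : ∀ e : E, (∀ e' : E, InvImage (Relation.TransGen
      (fun a b => ∃ e, F.tail e = a ∧ F.head e = b)) F.tail e' e → DualExt N) → DualExt N :=
    fun e rec => contract (F.direction (Sum.inl e)) (List.ofFn fun j =>
      Sum.rec (motive := fun x => F.target x = F.tail e → DualExt N)
        (fun e' h => rec e' (Relation.TransGen.single ⟨e', rfl, h⟩)) (fun i _ => f i)
        (σ e j).1 (σ e j).2).prod
  refine ⟨Sum.elim (hwf.fix step) f, fun i => rfl, fun e => ?_⟩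
  refine (hwf.fix_eq step e).trans ?_
  simp only [step]
  congr 3
  funext j
  rcases σ e j with ⟨e' | i, h⟩ <;> rfl

/-- The forms are rebuilt by the recursion, with the choices made for `ζ`, rather than extracted
from the polyvectors. All later arguments take place in the exterior algebra. -/
theorem IsZeta.exists_isFormFamily (hF : IsForest F.tail F.head) {ζ : E ⊕ I → Polyvector N}
    (hζ : F.IsZeta A ζ) :
    ∃ a, F.IsFormFamily A a ∧ ∀ x, ζ x = zmon (F.direction x) (a x) := by
  choose α hα hα' using hζ.1
  choose k σ hσ using hζ.2
  obtain ⟨a, ha, ha'⟩ := exists_family hF (fun i => (α i : DualExt N)) k σ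
  refine ⟨a, ⟨fun i => ⟨α i, hα i, ha i⟩, fun e => ⟨k e, σ e, ha' e⟩⟩, fun x => ?_⟩
  induction x using edge_induction hF with
  | leg i => rw [hα', ha]; rfl
  | edge e ih => rw [hσ, ell_eq_zmon hF e (σ e) fun j => ih _ (σ e j).2, ← ha']

theorem IsFormFamily.isHomog (hF : IsForest F.tail F.head) {a : E ⊕ I → DualExt N}
    (ha : F.IsFormFamily A a) (x : E ⊕ I) : IsHomog (a x) := by
  refine edge_induction (P := fun x => IsHomog (a x)) hF (fun i => ?_) (fun e ih => ?_) x
  · obtain ⟨α, -, h⟩ := ha.1 i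
    exact ⟨_, h ▸ α.2⟩
  · obtain ⟨k, σ, h⟩ := ha.2 e
    rw [h]
    refine IsHomog.contr _ (IsHomog.list_prod ?_)
    simp only [List.mem_ofFn, forall_exists_index]
    rintro _ j rfl
    exact ih _ (σ j).2

/-- Serves twice: with equal families it gives `isFlowFamily`, and with two families it is the
induction step for uniqueness up to sign. -/
theorem IsFormFamily.eqSign_contract (hF : IsForest F.tail F.head) {a a' : E ⊕ I → DualExt N}
    (ha' : F.IsFormFamily A a') (e : E)
    (h : ∀ x, F.target x = F.tail e → EqSign (a x) (a' x)) (l : List (E ⊕ I)) (hl : l.Nodup)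
    (hmem : ∀ x, x ∈ l ↔ F.target x = F.tail e) :
    EqSign (contract (F.direction (Sum.inl e)) (l.map a).prod) (a' (Sum.inl e)) := by
  obtain ⟨k, σ, h'⟩ := ha'.2 e
  have hperm : l.Perm (List.ofFn fun j => (σ j : E ⊕ I)) := by
    rw [List.perm_ext_iff_of_nodup hl (nodup_ofFn_subtype σ).1]
    intro x
    rw [hmem, (nodup_ofFn_subtype σ).2]
  have h1 := EqSign.list_prod (f := a) (g := a') fun x hx => h x ((hmem x).mp hx)
  have h2 := h1.trans (map_prod_perm hperm fun x _ => ha'.isHomog hF x)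
  rw [List.map_ofFn] at h2
  rw [h']
  exact h2.map (contract (F.direction (Sum.inl e)))

theorem IsFormFamily.isFlowFamily (hF : IsForest F.tail F.head) {a : E ⊕ I → DualExt N}
    (ha : F.IsFormFamily A a) :
    IsFlowFamily F.tail F.head T.leg (fun e => F.direction (Sum.inl e)) a where
  isHomog := ha.isHomog hF
  contract := fun e l hl hmem => ha.eqSign_contract hF e (fun _ _ => EqSign.refl _) l hl hmem

variable [Module.Free ℤ N] [Module.Finite ℤ N]

theorem exists_isFormFamily (hF : IsForest F.tail F.head) (A : AffineConstraint N I) :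
    ∃ a, F.IsFormFamily A a := by
  classical
  obtain ⟨a, ha, ha'⟩ := exists_family hF
    (fun i => ((A.weight i • A.primitiveForm i : ⋀[ℤ]^(A.codim i) (DualLattice N)) : DualExt N))
    (fun e => Fintype.card (F.Incoming (F.tail e))) fun e => (Fintype.equivFin _).symm
  exact ⟨a, fun i => ⟨_, A.isForm_smul_primitiveForm i, ha i⟩, fun e => ⟨_, _, ha' e⟩⟩

theorem IsFormFamily.eqSign (hF : IsForest F.tail F.head) {a a' : E ⊕ I → DualExt N}
    (ha : F.IsFormFamily A a) (ha' : F.IsFormFamily A a') (x : E ⊕ I) : EqSign (a x) (a' x) := by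
  refine edge_induction (P := fun x => EqSign (a x) (a' x)) hF (fun i => ?_) (fun e ih => ?_) x
  · obtain ⟨α, hα, h⟩ := ha.1 i
    obtain ⟨α', hα', h'⟩ := ha'.1 i
    rw [h, h']
    exact (hα.eqSign.symm.trans hα'.eqSign).map (Submodule.subtype _)
  · obtain ⟨k, σ, h⟩ := ha.2 e
    have := ha'.eqSign_contract hF e ih _ (nodup_ofFn_subtype σ).1 (nodup_ofFn_subtype σ).2
    rw [List.map_ofFn] at this
    rw [h]
    exact this

end Flow

end TropicalCurves

end

/-! ### The map `Φ` and its index. -/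

section

open ExteriorAlgebra Module

namespace TropicalCurves

variable {N I V E : Type*} [AddCommGroup N] [Fintype I] [DecidableEq V] [Fintype E]

namespace TropicalType

variable (T : TropicalType N I V E)

theorem mem_latticePoints_edgeDir [Module.Free ℤ N] [Module.Finite ℤ N] (e : E) {n : N} :
    n ∈ latticePoints (Submodule.span ℝ {toReal (T.edgeDir e)}) ↔ ∃ t : ℤ, t • T.edgeDir e = n := by
  refine mem_latticePoints_span_singleton ?_
  rcases Nat.eq_zero_or_pos (T.edgeWeight e) with h | h
  · exact Or.inr (T.edgeDir_zero e h)
  · exact Or.inl (T.edgeDir_primitive e h)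

/-- The components of `Φ` at the compact edges. -/
noncomputable def edgePhi : (V → N) →ₗ[ℤ]
    ((e : E) → N ⧸ latticePoints (Submodule.span ℝ {toReal (T.edgeDir e)})) :=
  LinearMap.pi fun e => (latticePoints (Submodule.span ℝ {toReal (T.edgeDir e)})).mkQ ∘ₗ
    ((LinearMap.proj (T.src e) : (V → N) →ₗ[ℤ] N) - LinearMap.proj (T.tgt e))

/-- The components of `Φ` at the legs. -/
noncomputable def legPhi (A : AffineConstraint N I) :
    (V → N) →ₗ[ℤ] ((i : I) → N ⧸ latticePoints (A.space i).direction) :=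
  LinearMap.pi fun i => (latticePoints (A.space i).direction).mkQ ∘ₗ LinearMap.proj (T.leg i)

variable {T} in
theorem mem_ker_edgePhi [Module.Free ℤ N] [Module.Finite ℤ N] {H : V → N} :
    H ∈ LinearMap.ker T.edgePhi ↔ ∀ e, ∃ t : ℤ, t • T.edgeDir e = H (T.src e) - H (T.tgt e) := by
  rw [LinearMap.mem_ker, funext_iff]
  refine forall_congr' fun e => ?_
  rw [← T.mem_latticePoints_edgeDir, ← Submodule.Quotient.mk_eq_zero]
  rfl

variable {T} in
theorem mem_ker_legPhi {A : AffineConstraint N I} {H : V → N} :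
    H ∈ LinearMap.ker (T.legPhi A) ↔ ∀ i, H (T.leg i) ∈ latticePoints (A.space i).direction := by
  rw [LinearMap.mem_ker, funext_iff]
  refine forall_congr' fun i => ?_
  rw [← Submodule.Quotient.mk_eq_zero]
  rfl

variable {T} {vinf : V} (F : Flow T vinf)

-- On a tree the differences along the edges can be prescribed freely: sum them along the paths to
-- the root.
include F in
theorem edgePhi_surjective (hF : IsForest F.tail F.head) : Function.Surjective T.edgePhi := by
  intro q
  choose g hg using fun e => Submodule.mkQ_surjective _ (q e)
  refine ⟨fun v => pathSum F.tail F.head v fun e => if F.forward e then g e else -g e,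
    funext fun e => ?_⟩
  rw [← hg e]
  have h := pathSum_tail hF e fun e => if F.forward e then g e else -g e
  rw [F.tail_eq, F.head_eq] at h
  refine congrArg (Submodule.mkQ _) ?_
  simp only [LinearMap.sub_apply, LinearMap.proj_apply]
  cases hf : F.forward e
  · simp only [hf, Bool.false_eq_true, if_false] at h
    rw [h]; abel
  · simp only [hf, if_true] at h
    rw [h]; abel

/-- A direction that is primitive or zero generates `ℝu_E ∩ N`, so edge differences are integral
multiples of it; the positions are then recovered by induction from the root. -/
theorem ker_edgePhi [Fintype V] [Module.Free ℤ N] [Module.Finite ℤ N] 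
    (hF : IsForest F.tail F.head) :
    LinearMap.ker T.edgePhi =
      LinearMap.range (LinearMap.pi (posMap F.tail F.head F.unitDir)) := by
  ext H
  rw [mem_ker_edgePhi]
  constructor
  · intro h
    have h' : ∀ e, ∃ t : ℤ, t • F.unitDir e = H (F.tail e) - H (F.head e) := by
      intro e
      obtain ⟨t, ht⟩ := h e
      rw [F.tail_eq, F.head_eq, Flow.unitDir]
      cases F.forward e
      · exact ⟨-t, by simp [ht]⟩
      · exact ⟨-t, by simp [ht]⟩
    choose t ht using h'
    refine ⟨(H vinf, t), funext fun v => ?_⟩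
    rw [LinearMap.pi_apply]
    induction v using hF.root_induction F.sink with
    | root => rw [posMap_apply, pathSum_root ((F.sink vinf).mpr rfl), add_zero]
    | step e ih =>
      rw [posMap_tail hF, LinearMap.add_apply, ih]
      change _ + t e • F.unitDir e = _
      rw [ht]; abel
  · rintro ⟨⟨m, t⟩, rfl⟩ e
    have h := LinearMap.congr_fun (posMap_tail hF F.unitDir e) (m, t)
    change _ = _ + t e • F.unitDir e at h
    rw [F.tail_eq, F.head_eq, Flow.unitDir] at h
    simp only [LinearMap.pi_apply]
    cases hf : F.forward e
    · simp only [hf, Bool.false_eq_true, if_false] at h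
      exact ⟨-t e, by rw [h, neg_smul]; abel⟩
    · simp only [hf, if_true] at h
      exact ⟨-t e, by rw [h, neg_smul, smul_neg]; abel⟩

theorem legPhi_comp (A : AffineConstraint N I) :
    T.legPhi A ∘ₗ LinearMap.pi (posMap F.tail F.head F.unitDir) =
      legMap F.tail F.head T.leg A F.unitDir := rfl

end TropicalType

namespace TropicalCurve

variable (Γ : TropicalCurve N I V E) (A : AffineConstraint N I)

theorem Phi_eq : Γ.Phi A = Γ.edgePhi.prod (Γ.legPhi A) := rfl

/-- A kernel vector `H` is a deformation: for small `ε > 0` the positions `pos + ε H` still have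
positive edge lengths and still match the constraints, so isolation forces `H = 0`. -/
theorem Phi_injective [Module.Free ℤ N] [Module.Finite ℤ N] (hiso : Γ.IsIsolated A) : Function.Injective (Γ.Phi A) := by
  rw [← LinearMap.ker_eq_bot, LinearMap.ker_eq_bot']
  intro H hH
  have h1 : H ∈ LinearMap.ker Γ.edgePhi := congrArg Prod.fst hH
  have h2 : H ∈ LinearMap.ker (Γ.legPhi A) := congrArg Prod.snd hH
  rw [TropicalType.mem_ker_edgePhi] at h1
  rw [TropicalType.mem_ker_legPhi] at h2
  choose t ht using h1
  choose c hc hpos using Γ.pos_mem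
  have hev : ∀ᶠ ε : ℝ in nhdsWithin 0 (Set.Ioi 0), (∀ e, ε * t e < c e) ∧ 0 < ε := by
    refine Filter.Eventually.and (Filter.eventually_all.mpr fun e => ?_) self_mem_nhdsWithin
    have : Filter.Tendsto (fun ε : ℝ => ε * t e) (nhdsWithin 0 (Set.Ioi 0)) (nhds (0 * t e)) :=
      ((continuous_id.mul continuous_const).tendsto 0).mono_left nhdsWithin_le_nhds
    rw [zero_mul] at this
    exact this.eventually_lt_const (hc e)
  obtain ⟨ε, hε, hε0⟩ := hev.exists
  have hΓ : Γ.pos ∈ Γ.constrainedFace A := by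
    rw [hiso]; rfl
  have hmem : (fun v => Γ.pos v + ε • toReal (H v)) ∈ Γ.constrainedFace A := by
    refine ⟨fun e => ⟨c e - ε * t e, sub_pos.mpr (hε e), ?_⟩, fun i s hs => ?_⟩
    · have h := congrArg toReal (ht e)
      rw [map_sub, map_smul, ← Int.cast_smul_eq_zsmul ℝ] at h
      rw [sub_smul, mul_smul, h, ← hpos, smul_sub, add_sub_add_comm, sub_eq_add_neg (_ - _), neg_sub]
    · have h := AffineSubspace.vadd_mem_of_mem_direction
        ((A.space i).direction.smul_mem ε (h2 i)) (hΓ.2 i s hs)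
      rw [vadd_eq_add, ← add_assoc, add_comm (ε • _)] at h
      exact h
  rw [hiso, Set.mem_singleton_iff] at hmem
  funext v
  have h := congrFun hmem v
  rw [add_eq_left, smul_eq_zero] at h
  exact toReal_injective ((h.resolve_left hε0.ne').trans (map_zero _).symm)

variable {vinf : V} (F : Flow Γ.toTropicalType vinf) [Fintype V] [Module.Free ℤ N]
  [Module.Finite ℤ N]

theorem latticeIndex_eq (hF : IsForest F.tail F.head) :
    Γ.latticeIndex A =
      (LinearMap.range (legMap F.tail F.head Γ.leg A F.unitDir)).toAddSubgroup.index := by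
  rw [latticeIndex, Phi_eq, index_range_prod _ _ (TropicalType.edgePhi_surjective F hF),
    TropicalType.ker_edgePhi F hF, ← LinearMap.range_comp, TropicalType.legPhi_comp]

/-- The parametrization sends the kernel of `legMap` into that of `Φ`, and it is itself injective
once no edge has direction zero. -/
theorem legMap_injective (hF : IsForest F.tail F.head) (hu : ∀ e, Γ.edgeDir e ≠ 0)
    (h : Function.Injective (Γ.Phi A)) :
    Function.Injective (legMap F.tail F.head Γ.leg A F.unitDir) := by
  rw [← LinearMap.ker_eq_bot, LinearMap.ker_eq_bot']
  rintro ⟨m, t⟩ hx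
  set H : V → N := LinearMap.pi (posMap F.tail F.head F.unitDir) (m, t) with hH
  have h1 : H ∈ LinearMap.ker Γ.edgePhi := by
    rw [TropicalType.ker_edgePhi F hF]
    exact LinearMap.mem_range_self _ _
  have h2 : H = 0 := h (by
    rw [map_zero]
    exact Prod.ext h1 hx)
  have hv : ∀ v, posMap F.tail F.head F.unitDir v (m, t) = 0 := fun v => congrFun h2 v
  refine Prod.ext ?_ (funext fun e => ?_)
  · have := hv vinf
    rwa [posMap_apply, pathSum_root ((F.sink vinf).mpr rfl), add_zero] at this
  · have h3 := LinearMap.congr_fun (posMap_tail hF F.unitDir e) (m, t)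
    rw [LinearMap.add_apply, hv, hv, zero_add] at h3
    have h4 : t e • F.unitDir e = 0 := h3.symm
    have : IsAddTorsionFree N := Module.isTorsionFree_int_iff_isAddTorsionFree.mp inferInstance
    refine (smul_eq_zero.mp h4).resolve_right ?_
    rw [Flow.unitDir]
    split_ifs
    · exact neg_ne_zero.mpr (hu e)
    · exact hu e

end TropicalCurve

/-! ### Dimension count excluding contracted edges. -/

namespace TropicalType

variable (T : TropicalType N I V E)

/-- In the sum of the valences compact edges count twice and legs once; with `#V = #E + 1` all other
terms cancel. -/
theorem expectedDim_eq [Fintype V] (hgenus : T.genus = 0) (hv : ∀ v, T.vertexGenus v = 0) :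
    T.expectedDim = finrank ℤ N + Fintype.card E := by
  have hcard := Flow.card_edges hgenus hv
  have hval : ∑ v, T.valence v = Fintype.card E + Fintype.card E + Fintype.card I := by
    simp only [valence, graphValence, Finset.sum_add_distrib]
    rw [Finset.sum_comm, Finset.sum_comm (f := fun v e => if T.tgt e = v then 1 else 0),
      Finset.sum_comm (f := fun v e => if T.leg e = v then 1 else 0)]
    simp
  have hov : ∑ v, T.overValence v = (∑ v, T.valence v : ℕ) - 3 * Fintype.card V := by
    simp [overValence, hv, Finset.sum_sub_distrib, mul_comm]
  rw [expectedDim, hov, hval, hgenus, ← hcard]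
  push_cast
  ring

/-- The linear space parallel to the affine span of the face. -/
def faceSpace : Submodule ℝ (V → RealSpace N) :=
  ⨅ e, (Submodule.span ℝ {toReal (T.edgeDir e)}).comap
    ((LinearMap.proj (T.tgt e) : (V → RealSpace N) →ₗ[ℝ] RealSpace N) - LinearMap.proj (T.src e))

theorem vectorSpan_face_le : vectorSpan ℝ T.face ≤ T.faceSpace := by
  rw [vectorSpan, Submodule.span_le]
  rintro _ ⟨p, hp, q, hq, rfl⟩
  rw [SetLike.mem_coe, faceSpace, Submodule.mem_iInf]
  intro e
  obtain ⟨c, -, hc⟩ := hp e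
  obtain ⟨d, -, hd⟩ := hq e
  refine Submodule.mem_span_singleton.mpr ⟨c - d, ?_⟩
  rw [sub_smul, ← hc, ← hd]
  simp only [LinearMap.sub_apply, LinearMap.proj_apply, vsub_eq_sub, Pi.sub_apply]
  abel

variable [Module.Free ℤ N] [Module.Finite ℤ N]

/-- By connectedness, a vector of `faceSpace` is determined by its value at one vertex and the
coefficients of the edge differences; an edge of direction zero has no such coefficient. -/
theorem finrank_faceSpace_le :
    finrank ℝ T.faceSpace ≤ finrank ℤ N + Nat.card {e // T.edgeDir e ≠ 0} := by
  classical
  have hf : ∀ e : {e // T.edgeDir e ≠ 0},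
      ∃ f : RealSpace N →ₗ[ℝ] ℝ, f (toReal (T.edgeDir e)) = 1 := by
    intro e
    have hu : toReal (T.edgeDir e) ≠ 0 := fun h =>
      e.2 (toReal_injective (h.trans (map_zero _).symm))
    obtain ⟨f, hf⟩ := LinearMap.exists_leftInverse_of_injective
      (LinearMap.toSpanSingleton ℝ (RealSpace N) (toReal (T.edgeDir e)))
      (LinearMap.ker_toSpanSingleton ℝ hu)
    exact ⟨f, by simpa using LinearMap.congr_fun hf 1⟩
  choose f hf using hf
  obtain ⟨v₀⟩ := T.nonempty
  let g : (V → RealSpace N) →ₗ[ℝ] RealSpace N × ({e // T.edgeDir e ≠ 0} → ℝ) :=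
    (LinearMap.proj v₀).prod (LinearMap.pi fun e => f e ∘ₗ
      ((LinearMap.proj (T.tgt e) : (V → RealSpace N) →ₗ[ℝ] RealSpace N) -
        LinearMap.proj (T.src e)))
  have hinj : Function.Injective (g ∘ₗ T.faceSpace.subtype) := by
    rw [← LinearMap.ker_eq_bot, LinearMap.ker_eq_bot']
    rintro ⟨p, hp⟩ hgp
    rw [faceSpace, Submodule.mem_iInf] at hp
    have h0 : p v₀ = 0 := congrArg Prod.fst hgp
    have hedge : ∀ e, p (T.src e) = p (T.tgt e) := by
      intro e
      obtain ⟨c, hc⟩ := Submodule.mem_span_singleton.mp (hp e)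
      change c • _ = p (T.tgt e) - p (T.src e) at hc
      by_cases he : T.edgeDir e = 0
      · rw [he, map_zero, smul_zero] at hc
        exact (sub_eq_zero.mp hc.symm).symm
      · have h1 : f ⟨e, he⟩ (p (T.tgt e) - p (T.src e)) = 0 :=
          congrFun (congrArg Prod.snd hgp) ⟨e, he⟩
        rw [← hc, map_smul, hf ⟨e, he⟩, smul_eq_mul, mul_one] at h1
        rw [h1, zero_smul] at hc
        exact (sub_eq_zero.mp hc.symm).symm
    refine Subtype.ext (funext fun v => ?_)
    have hconst : ∀ a b, Relation.EqvGen (fun x y => ∃ e, T.src e = x ∧ T.tgt e = y) a b →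
        p a = p b := by
      intro a b hab
      induction hab with
      | rel a b h => obtain ⟨e, rfl, rfl⟩ := h; exact hedge e
      | refl a => rfl
      | symm a b _ ih => exact ih.symm
      | trans a b c _ _ ih ih' => exact ih.trans ih'
    exact (hconst v v₀ (T.connected v v₀)).trans h0
  have h := LinearMap.finrank_le_finrank_of_injective hinj
  rwa [Module.finrank_prod, Module.finrank_baseChange, Module.finrank_fintype_fun_eq_card,
    ← Nat.card_eq_fintype_card] at h

/-- Such an edge would contribute no length, leaving the face with dimension below the expected `r +
#E`. -/
theorem edgeDir_ne_zero [Fintype V] (hgenus : T.genus = 0) (hns : T.NonSuperabundant) (e : E) :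
    T.edgeDir e ≠ 0 := by
  intro he
  have h1 := hns.2.2
  rw [T.expectedDim_eq hgenus hns.2.1] at h1
  have h2 := (Submodule.finrank_mono T.vectorSpan_face_le).trans T.finrank_faceSpace_le
  classical
  have h3 : Nat.card {e // T.edgeDir e ≠ 0} < Fintype.card E := by
    rw [Nat.card_eq_fintype_card]
    exact Fintype.card_subtype_lt (x := e) (not_not.mpr he)
  omega

end TropicalType

end TropicalCurves

end

/-! ### Comparison of the two computations and conclusion. -/

namespace TropicalCurves

open ExteriorAlgebra Module

variable {N I V E : Type*} [AddCommGroup N] [Module.Free ℤ N] [Module.Finite ℤ N]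
  [Fintype I] [DecidableEq V] [Fintype E]

theorem _root_.List.prod_map_smul {R ι : Type*} [Ring R] (l : List ι) (w : ι → ℕ) (x : ι → R) :
    (l.map fun i => w i • x i).prod = (l.map w).prod • (l.map x).prod := by
  induction l with
  | nil => simp
  | cons i l ih =>
    simp only [List.map_cons, List.prod_cons, ih, smul_mul_smul_comm]

namespace Flow

variable {T : TropicalType N I V E} {vinf : V} {F : Flow T vinf} {A : AffineConstraint N I}

/-- The product of the forms at the sink, up to sign. -/
theorem IsFormFamily.prod_eqSign [Fintype V] [DecidableEq I] (hF : IsForest F.tail F.head)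
    {a : E ⊕ I → DualExt N} (ha : F.IsFormFamily A a) {r : ℕ} (b : Basis (Fin r) ℤ N)
    (ρ : (Σ i, Fin (A.codim i)) ≃ Fin r ⊕ E) {L : List (E ⊕ I)} (hL : L.Nodup)
    (hL' : ∀ x, x ∈ L ↔ F.target x = vinf) :
    EqSign (((∏ i, A.weight i : ℕ) : ℤ) •
        legDet b A (fun e => F.direction (Sum.inl e)) ρ F.tail F.head T.leg •
          (ExteriorAlgebra.ιMulti ℤ r b.dualBasis : DualExt N)) (L.map a).prod := by
  classical
  set u : E → N := fun e => F.direction (Sum.inl e)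
  obtain ⟨l, hl, hl', hprod⟩ := exists_contrList_eqSign hF (ha.isFlowFamily hF) F.sink
    (Finset.nodup_toList (Finset.univ : Finset I)) (fun i => Finset.mem_toList.mpr (Finset.mem_univ i))
    hL hL'
  set l₀ := (Finset.univ : Finset I).toList
  refine EqSign.trans ?_ hprod
  let g := (ExteriorAlgebra.map (LinearMap.inl ℤ N (E → ℤ)).dualMap).toLinearMap ∘ₗ
    contrList (l.map edgeEval)
  have h1 : EqSign (((∏ i, A.weight i : ℕ) : ℤ) •
      (l₀.map fun i => pull F.tail F.head u (T.leg i) (A.primitiveForm i : DualExt N)).prod)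
      (l₀.map fun i => pull F.tail F.head u (T.leg i) (a (Sum.inr i))).prod := by
    have hw : (l₀.map A.weight).prod = ∏ i, A.weight i := Finset.prod_map_toList _ _
    rw [← hw, natCast_zsmul, ← List.prod_map_smul]
    refine EqSign.list_prod fun i _ => ?_
    obtain ⟨α, hα, h⟩ := ha.1 i
    rw [← map_nsmul, h]
    exact (hα.eqSign.map (Submodule.subtype _)).map (pull F.tail F.head u (T.leg i))
  have h2 := h1.map g
  rw [map_smul] at h2
  refine EqSign.trans ?_ h2
  exact (contrList_prod_primitiveForm b A u ρ (Finset.nodup_toList _)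
    (fun i => Finset.mem_toList.mpr (Finset.mem_univ i)) hl hl').map
    (LinearMap.lsmul ℤ (DualExt N) ((∏ i, A.weight i : ℕ) : ℤ))

end Flow

end TropicalCurves

open TropicalCurves in
theorem mainTheorem2 {N I V E : Type*} [AddCommGroup N] [Module.Free ℤ N] [Module.Finite ℤ N]
    [Fintype I] [Fintype V] [DecidableEq V] [Fintype E]
    (Γ : TropicalCurve N I V E) (A : AffineConstraint N I)
    (s : {i : I // Γ.legWeight i = 0} → ℕ)
    (hgenus : Γ.genus = 0) (hA : Γ.Matches A) (hs : Γ.SatisfiesPsi s)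
    (hns : Γ.NonSuperabundant) (hdim : ((∑ i, A.codim i : ℕ) : ℤ) = Γ.expectedDim)
    (vinf : V) (F : Flow Γ.toTropicalType vinf) :
    (Γ.IsIsolated A → Function.Injective (Γ.Phi A) ∧
      (LinearMap.range (Γ.Phi A)).toAddSubgroup.FiniteIndex) ∧
    (∃ ζ, F.IsZeta A ζ) ∧
    (∀ ζ ζ', F.IsZeta A ζ → F.IsZeta A ζ' → ∀ x, ζ' x = ζ x ∨ ζ' x = -ζ x) ∧
    ∀ ζ, F.IsZeta A ζ →
      (∀ x, ∃ α, ζ x = zmon (F.direction x) α) ∧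
      ∀ (k : ℕ) (σ : Fin k ≃ Γ.EdgesAt vinf),
        ∃ ω : ⋀[ℤ]^(Module.finrank ℤ N) (DualLattice N),
          (List.ofFn fun j => ζ (σ j)).prod = zmon 0 (ω : DualExt N) ∧
          HasIndex ω ((∏ i, A.weight i) * Γ.mult A) ∧
          ∀ Ω : ⋀[ℤ]^(Module.finrank ℤ N) N, IsPrimitive Ω →
            |exteriorPower.pairingDual ℤ N (Module.finrank ℤ N) ω Ω| =
              (((∏ i, A.weight i) * Γ.mult A : ℕ) : ℤ) := by
  classical
  have hF : IsForest F.tail F.head := F.isForest (Flow.card_edges hgenus hns.2.1)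
  let b := Module.finBasis ℤ N
  have hcodim : ∑ i, A.codim i = Module.finrank ℤ N + Fintype.card E := by
    rw [Γ.expectedDim_eq hgenus hns.2.1] at hdim
    exact_mod_cast hdim
  -- This identification of index sets makes the matrix of `legMap` square; it can affect the
  -- determinant only by a sign.
  let ρ : (Σ i, Fin (A.codim i)) ≃ Fin (Module.finrank ℤ N) ⊕ E :=
    Fintype.equivOfCardEq (by simp [hcodim])
  refine ⟨fun hiso => ?_, ?_, fun ζ ζ' hζ hζ' x => ?_, fun ζ hζ => ?_⟩
  · have hinj := Γ.Phi_injective A hiso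
    refine ⟨hinj, ⟨?_⟩⟩
    change Γ.latticeIndex A ≠ 0
    rw [Γ.latticeIndex_eq A F hF]
    exact index_range_ne_zero ((prodBasis b).reindex ρ.symm) A.prodBasis
      (Γ.legMap_injective A F hF (Γ.edgeDir_ne_zero hgenus hns) hinj)
  · obtain ⟨a, ha⟩ := Flow.exists_isFormFamily hF A
    exact ⟨_, ha.isZeta hF⟩
  · obtain ⟨a, ha, h⟩ := hζ.exists_isFormFamily hF
    obtain ⟨a', ha', h'⟩ := hζ'.exists_isFormFamily hF
    rw [h, h']
    exact (ha.eqSign hF ha' x).map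
      (TensorProduct.mk ℤ (AddMonoidAlgebra ℤ N) (DualExt N) (AddMonoidAlgebra.single _ 1))
  · obtain ⟨a, ha, h⟩ := hζ.exists_isFormFamily hF
    refine ⟨fun x => ⟨_, h x⟩, fun k σ => ?_⟩
    obtain ⟨hnd, hmem⟩ := Flow.nodup_ofFn_subtype σ
    replace hmem := fun x => (hmem x).trans (F.edgesAt_iff x)
    set c : ℤ := ((∏ i, A.weight i : ℕ) : ℤ) *
      legDet b A (fun e => F.direction (Sum.inl e)) ρ F.tail F.head Γ.leg with hc
    have hprod := ha.prod_eqSign hF b ρ hnd hmem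
    rw [smul_smul, ← hc, List.map_ofFn] at hprod
    -- The determinant for the weighted directions supplies both the index of `Φ` and the factor `∏
    -- w(E)`.
    have hcabs : c.natAbs = (∏ i, A.weight i) * Γ.mult A := by
      simp only [F.direction_inl] at hc
      rw [hc, legDet_smul, Int.natAbs_mul, Int.natAbs_mul, Int.natAbs_natCast, Int.natAbs_natCast,
        ← index_range_legMap, ← Γ.latticeIndex_eq A F hF, TropicalCurve.mult]
      ring
    obtain ⟨c', hc', hω⟩ : ∃ c' : ℤ, c'.natAbs = c.natAbs ∧ (List.ofFn (a ∘ fun j => (σ j).1)).prod =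
        c' • (ExteriorAlgebra.ιMulti ℤ _ b.dualBasis : DualExt N) := by
      rcases hprod with hp | hp
      · exact ⟨c, rfl, hp⟩
      · exact ⟨-c, Int.natAbs_neg c, by rw [hp, neg_smul]⟩
    refine ⟨c' • exteriorPower.ιMulti ℤ _ b.dualBasis, ?_, ?_, fun Ω hΩ => ?_⟩
    · have hsum := F.sum_incoming_sink hnd hmem
      have hl := list_prod_zmon (List.ofFn fun j => (F.direction (σ j).1, a (σ j).1))
      rw [List.map_ofFn, List.map_ofFn, List.map_ofFn] at hl
      rw [List.map_ofFn] at hsum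
      simp only [h]
      refine hl.trans ?_
      change zmon (List.ofFn (F.direction ∘ fun j => (σ j).1)).sum
        (List.ofFn (a ∘ fun j => (σ j).1)).prod = _
      rw [hsum, hω]
      rfl
    · rw [← hcabs, ← hc']
      exact hasIndex_of_eq_smul b rfl
    · rw [← hcabs, ← hc']
      exact abs_pairingDual_of_eq_smul b rfl hΩ
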